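/- Let $d=2m+1$ be odd, so that $m=\frac{d-1}{2}$. Write $\hat f(\xi)=\int_{\mathbb{R}^d}f(x)e^{-2\pi i\langle x,\xi\rangle}\,dx$. On $\mathbb{R}^{d-1}$ put $$\|u\|_{B_2^{-m,\infty}}=\sup_{k\ge 0}2^{-mk}\|P_ku\|_{L_2},\qquad \|u\|_{H^{-s}}=\Big(\int_{\mathbb{R}^{d-1}}|\hat u(z)|^2(1+|z|)^{-2s}\,dz\Big)^{1/2},$$ where $P_0$ is the Fourier projector onto the unit ball $B_1(0)$ and $P_k$, $k\ge1$, is the Fourier projector onto $B_{2^k}(0)\setminus B_{2^{k-1}}(0)$. (1) Local form. Let $U\subseteq\mathbb{R}^{d-1}$ be open, let $h\in C^\infty(U;\mathbb{R})$ have nondegenerate Hessian at every point of $U$, and let $\psi\in C_0^\infty(U)$. Then for all Schwartz functions $f$ $$\Big\|\psi(\cdot)\,\frac{\partial^{m}\hat f}{\partial\xi_d^{m}}(\cdot,h(\cdot))\Big\|_{B_2^{-m,\infty}(\mathbb{R}^{d-1})}\le C\,\|f\|_{L_1(\mathbb{R}^d)}$$ with $C$ independent of $f$. Moreover, the map $f\mapsto\psi(\cdot)\frac{\partial^{m}\hat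 f}{\partial\xi_d^{m}}(\cdot,h(\cdot))$ extends continuously from Schwartz functions to all $f\in L_1(\mathbb{R}^d)$, with values in tempered distributions, and the same bound holds for the extension. (2) Global form. Let $\Sigma\subset\mathbb{R}^d$ be a closed set that is a smooth embedded $(d-1)$-dimensional submanifold all of whose principal curvatures are nonzero at every point, and let $\phi\in C_0^\infty(\mathbb{R}^d)$. Choose any finite system of smooth local parametrizations $\gamma_j$ of $\Sigma$ and subordinate smooth compactly supported cutoffs $\chi_j$ with $\sum_j\chi_j=1$ on $\Sigma\cap\operatorname{supp}\phi$, and define the norm in $B_2^{-m,\infty}(\Sigma)$ (respectively $H^{-s}(\Sigma)$) of a distribution $u$ on $\Sigma$ supported in $\operatorname{supp}\phi$ as $\sum_j\|(\chi_ju)\circ\gamma_j\|$ with the corresponding norm on $\mathbb{R}^{d-1}$; for tensors, sum over the components. Then for all Schwartz functions $f$ $$\big\|(\phi\nabla^{m}\hat f)|_\Sigma\big\|_{B_2^{-m,\infty}(\Sigma)}\le C\,\|f\|_{L_1(\mathbb{R}^d)},\qquad \big\|(\phi\nabla^{m}\hat f)|_\Sigma\big\|_{H^{-s}(\Sigma)}\le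 C_s\,\|f\|_{L_1(\mathbb{R}^d)}\quad\text{for every } s>m,$$ with $C$, $C_s$ independent of $f$. Moreover, the maps $f\mapsto\big(\chi_j\,\phi\,\partial^\alpha\hat f\big)\circ\gamma_j$, $|\alpha|=m$, extend continuously from Schwartz functions to all $f\in L_1(\mathbb{R}^d)$, with values in tempered distributions on $\mathbb{R}^{d-1}$, and the same bounds hold for the extensions. -/

import Mathlib

open MeasureTheory Topology
open scoped ENNReal NNReal SchwartzMap FourierTransform ContDiff

noncomputable section

/-- The Euclidean space `ℝⁿ`. -/
abbrev Rn (n : ℕ) : Type := EuclideanSpace ℝ (Fin n)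

/-! ### Besov and Bessel potential norms on `ℝⁿ` -/

/-- The Fourier transform of the tempered distribution `u` is the function `g`.
(Testing against all Schwartz functions makes `g` locally integrable, and unique almost
everywhere.) -/
def HasFourierDensity {n : ℕ} (u : 𝓢'(Rn n, ℂ)) (g : Rn n → ℂ) : Prop :=
  ∀ η : 𝓢(Rn n, ℂ), Integrable (fun z => η z * g z) ∧ (𝓕 u) η = ∫ z, η z * g z

/-- The frequency regions of the Littlewood--Paley projectors: the unit ball for `k = 0`, and
the annulus `B(0, 2 ^ k) \ B(0, 2 ^ (k - 1))` for `k ≥ 1`. -/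
def dyadicRegion (n : ℕ) : ℕ → Set (Rn n)
  | 0 => Metric.ball 0 1
  | k + 1 => Metric.ball 0 (2 ^ (k + 1)) \ Metric.ball 0 (2 ^ k)

/-- The norm of the Besov space `B_2^{r, ∞}(ℝⁿ)`, that is `sup_k 2 ^ (r k) ‖P_k u‖_{L_2}`, where
`P_k` is the Fourier projector onto the `k`-th dyadic region; `‖P_k u‖_{L_2}` is computed on the
Fourier side (Plancherel).  The infimum is over the almost everywhere unique Fourier density of
`u`; the value is `∞` if there is none. -/
def besovNorm {n : ℕ} (r : ℝ) (u : 𝓢'(Rn n, ℂ)) : ℝ≥0∞ :=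
  ⨅ (g : Rn n → ℂ) (_ : HasFourierDensity u g),
    ⨆ k : ℕ, (2 : ℝ≥0∞) ^ (r * k) * eLpNorm ((dyadicRegion n k).indicator g) 2 volume

/-- The norm of the Bessel potential space `H^r(ℝⁿ)`, that is
`(∫ |û(z)|² (1 + |z|) ^ (2 r) dz) ^ (1 / 2)`; it is `∞` if `û` is not a function. -/
def sobolevNorm {n : ℕ} (r : ℝ) (u : 𝓢'(Rn n, ℂ)) : ℝ≥0∞ :=
  ⨅ (g : Rn n → ℂ) (_ : HasFourierDensity u g),
    eLpNorm (fun z => (((1 + ‖z‖) ^ r : ℝ) : ℂ) * g z) 2 volume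

/-- The tempered distribution `u` is given by integration against the function `F`. -/
def IsGivenBy {n : ℕ} (u : 𝓢'(Rn n, ℂ)) (F : Rn n → ℂ) : Prop :=
  ∀ η : 𝓢(Rn n, ℂ), u η = ∫ ζ, η ζ * F ζ

/-! ### Derivatives of the Fourier transform -/

/-- The component `∂_{α 1} ⋯ ∂_{α k} f̂ (ξ)` of the tensor `∇^k f̂ (ξ)`; here
`f̂ (ξ) = ∫ e^{-2 π i ⟨x, ξ⟩} f x dx`. -/
def gradFourier {d k : ℕ} (f : 𝓢(Rn d, ℂ)) (α : Fin k → Fin d) (ξ : Rn d) : ℂ :=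
  iteratedFDeriv ℝ k (𝓕 (f : Rn d → ℂ)) ξ (fun i => EuclideanSpace.single (α i) 1)

/-! ### Graphs -/

/-- The point `(ζ, h ζ)` of `ℝⁿ⁺¹`. -/
def graphPoint {n : ℕ} (h : Rn n → ℝ) (ζ : Rn n) : Rn (n + 1) :=
  WithLp.toLp 2 (Fin.snoc (α := fun _ => ℝ) (fun i => ζ i) (h ζ))

/-- The Hessian matrix of `h` at `ζ`. -/
def hessian {n : ℕ} (h : Rn n → ℝ) (ζ : Rn n) : Matrix (Fin n) (Fin n) ℝ :=
  Matrix.of fun i j =>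
    iteratedFDeriv ℝ 2 h ζ ![EuclideanSpace.single i 1, EuclideanSpace.single j 1]

/-! ### Hypersurfaces in `ℝⁿ⁺¹` -/

/-- A smooth local parametrization of `S ⊆ ℝⁿ⁺¹`: a homeomorphism of an open subset of `ℝⁿ` onto a
relatively open subset of `S` which is a smooth immersion into `ℝⁿ⁺¹`. -/
structure LocalParam {n : ℕ} (S : Set (Rn (n + 1))) where
  chart : OpenPartialHomeomorph (Rn n) S
  smooth : ContDiffOn ℝ ∞ (fun ζ => (chart ζ : Rn (n + 1))) chart.source
  immersion : ∀ ζ ∈ chart.source,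
    Function.Injective (fderiv ℝ (fun ζ => (chart ζ : Rn (n + 1))) ζ)

/-- The parametrization as a map into `ℝⁿ⁺¹`; only its values on `P.chart.source` matter. -/
def LocalParam.map {n : ℕ} {S : Set (Rn (n + 1))} (P : LocalParam S) (ζ : Rn n) : Rn (n + 1) :=
  (P.chart ζ : Rn (n + 1))

/-- `S` is a smooth embedded `n`-dimensional submanifold of `ℝⁿ⁺¹`. -/
def IsSmoothHypersurface {n : ℕ} (S : Set (Rn (n + 1))) : Prop :=
  ∀ p : S, ∃ P : LocalParam S, p ∈ P.chart.target

/-- `κ` is a principal curvature at the point `γ ζ` of the hypersurface parametrized by `γ`, with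
respect to the unit normal `ν`: an eigenvalue of the second fundamental form relative to the
first one. -/
def IsPrincipalCurvature {n : ℕ} (γ : Rn n → Rn (n + 1)) (ζ : Rn n) (ν : Rn (n + 1))
    (κ : ℝ) : Prop :=
  ∃ v : Rn n, v ≠ 0 ∧ ∀ w : Rn n,
    inner ℝ (iteratedFDeriv ℝ 2 γ ζ ![v, w]) ν = κ * inner ℝ (fderiv ℝ γ ζ v) (fderiv ℝ γ ζ w)

/-- The principal curvatures of `S` are nonzero at every point. -/
def NonvanishingPrincipalCurvatures {n : ℕ} (S : Set (Rn (n + 1))) : Prop :=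
  ∀ (P : LocalParam S), ∀ ζ ∈ P.chart.source, ∀ ν : Rn (n + 1), ‖ν‖ = 1 →
    (∀ v, inner ℝ (fderiv ℝ P.map ζ v) ν = 0) →
    ∀ κ : ℝ, IsPrincipalCurvature P.map ζ ν κ → κ ≠ 0

/-- A finite system of local parametrizations of `S` with smooth cutoffs subordinate to it, whose
sum is `1` on `S ∩ K`.  For a distribution `u` on `S` supported in `K`, the norm of `u` in a
function space on `S` is the sum over `j` of the norms of `(χ j • u) ∘ param j` in the
corresponding space on `ℝⁿ`; different systems give equivalent norms. -/
structure ChartSystem {n : ℕ} (S K : Set (Rn (n + 1))) where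
  N : ℕ
  param : Fin N → LocalParam S
  χ : Fin N → Rn (n + 1) → ℝ
  smooth : ∀ j, ContDiff ℝ ∞ (χ j)
  compact : ∀ j, HasCompactSupport (χ j)
  subordinate : ∀ j, ∀ p : S, (p : Rn (n + 1)) ∈ tsupport (χ j) → p ∈ (param j).chart.target
  sum_eq_one : ∀ p ∈ S ∩ K, ∑ j, χ j p = 1

open Manifold in
/-- Chart systems exist over every compact set. -/
theorem ChartSystem.nonempty {n : ℕ} {S K : Set (Rn (n + 1))} (hS : IsClosed S)
    (hP : IsSmoothHypersurface S) (hK : IsCompact K) : Nonempty (ChartSystem S K) := by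
  classical
  choose P hPt using hP
  have hW : ∀ p : S, ∃ W : Set (Rn (n + 1)), IsOpen W ∧
      Subtype.val ⁻¹' W = (P p).chart.target := fun p =>
    isOpen_induced_iff.1 (P p).chart.open_target
  choose W hWo hWt using hW
  have hc : IsCompact (S ∩ K) := hK.inter_left hS
  obtain ⟨t, ht⟩ := hc.elim_finite_subcover (fun p : S => W p ∩ Metric.ball (p : Rn (n + 1)) 1)
    (fun p => (hWo p).inter Metric.isOpen_ball) (fun x hx => by
      refine Set.mem_iUnion.2 ⟨⟨x, hx.1⟩, ?_, Metric.mem_ball_self one_pos⟩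
      have : (⟨x, hx.1⟩ : S) ∈ Subtype.val ⁻¹' W ⟨x, hx.1⟩ := by rw [hWt]; exact hPt _
      exact this)
  let e := t.equivFin.symm
  obtain ⟨ρ, hρ⟩ := SmoothPartitionOfUnity.exists_isSubordinate 𝓘(ℝ, Rn (n + 1)) hc.isClosed
    (fun j : Fin t.card => W (e j) ∩ Metric.ball ((e j : S) : Rn (n + 1)) 1)
    (fun j => (hWo _).inter Metric.isOpen_ball) (fun x hx => by
      obtain ⟨p, hp, hxp⟩ := Set.mem_iUnion₂.1 (ht hx)
      refine Set.mem_iUnion.2 ⟨e.symm ⟨p, hp⟩, ?_⟩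
      simpa using hxp)
  refine ⟨⟨t.card, fun j => P (e j), fun j => ρ j, fun j => (ρ j).contMDiff.contDiff,
    fun j => ?_, fun j p hp => ?_, fun p hp => ?_⟩⟩
  · exact Metric.isCompact_of_isClosed_isBounded (isClosed_tsupport _)
      (Metric.isBounded_ball.subset ((hρ j).trans Set.inter_subset_right))
  · rw [← hWt]; exact (hρ j hp).1
  · rw [← finsum_eq_sum_of_fintype]; exact ρ.sum_eq_one hp

/-- The function `(χ j • F) ∘ param j` on `ℝⁿ`, extended by zero outside of the domain of
`param j`. -/
def ChartSystem.localize {n : ℕ} {S K : Set (Rn (n + 1))} (A : ChartSystem S K) (j : Fin A.N)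
    (F : Rn (n + 1) → ℂ) : Rn n → ℂ :=
  (A.param j).chart.source.indicator
    fun ζ => (A.χ j ((A.param j).map ζ) : ℂ) * F ((A.param j).map ζ)

end

/-! Multiplication by `gradSymbol α`, the symbol `c(x)` of `∂^α`, turns derivatives of the transform
into weights on `f`. By Fubini the localized trace of a Schwartz function `f` has Fourier transform
`z ↦ ∫ f(x) c(x) K(x, z) dx`. Here `K(x, z) = ∫ ψ(ζ) exp(-2πi(⟨x, γ ζ⟩ + ⟨z, ζ⟩)) dζ` is
`surfaceKernel`, and `|c(x)| ≲ |x|^m`. This formula makes sense for every `f` in `L¹` and defines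
the extension. By Minkowski's inequality (`lintegral_enorm_kernelTransform_sq_le`) the Besov bound
reduces to an estimate uniform in `x`: the integral of `|c(x) K(x, z)|²` over `|z| < 2^j` is
`O(2^(2mj))`.

There are two regimes (`exists_lintegral_ball_mul_surfaceKernel_le`). If `2^j ≤ δ|x|`, the term `⟨x,
γ ζ⟩` dominates the phase and nondegeneracy gives `|K|² ≲ |x|^(-2m)`. The integrand is then bounded,
and the ball in dimension `2m` has volume of order `2^(2mj)`. If `2^j > δ|x|`, Plancherel in `z`
gives `∫ |K|² = ∫ |ψ|²`, while `|x|^(2m) ≲ 2^(2mj)`. The Sobolev bound for `s > m` follows by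
summing a geometric series over the dyadic regions.

The decay of `K` is proved without a normal form for the phase. The square of an oscillatory
integral is at most the integral over shifts `v` of its autocorrelations. The phase of the
autocorrelation is `t|v|` times a difference quotient, whose gradient is close to the Hessian
applied to `v/|v|` and hence bounded below. Nonstationary phase then gives decay in `t|v|`, and
integration over `v` yields `t^(-n)`, with `n` the dimension of the `ζ`-space. All bounds are
uniform for parameters near a compact set, here the unit sphere of directions `x/|x|` together with
`z/|x|` near `0`. -/

/-! ### Nonstationary phase with parameters -/

section OscillatoryIntegrals

variable {P E F : Type*} [NormedAddCommGroup P] [NormedSpace ℝ P]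
  [NormedAddCommGroup E] [NormedSpace ℝ E] [NormedAddCommGroup F] [NormedSpace ℝ F]

/-- The partial derivative with respect to the second variable. -/
noncomputable def sndFDeriv (f : P × E → F) (q : P × E) : E →L[ℝ] F :=
  (fderiv ℝ f q).comp (ContinuousLinearMap.inr ℝ P E)

theorem ContDiff.sndFDeriv {f : P × E → F} (hf : ContDiff ℝ ∞ f) :
    ContDiff ℝ ∞ (sndFDeriv f) :=
  (hf.fderiv_right (m := ∞) (by norm_cast)).clm_comp contDiff_const

theorem hasFDerivAt_sndFDeriv {f : P × E → F} (hf : ContDiff ℝ ∞ f) (p : P) (ζ : E) :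
    HasFDerivAt (fun ζ => f (p, ζ)) (sndFDeriv f (p, ζ)) ζ :=
  ((hf.differentiable (by simp)) (p, ζ)).hasFDerivAt.comp ζ (hasFDerivAt_prodMk_right p ζ)

theorem ContDiff.comp_prodMk_right {f : P × E → F} (hf : ContDiff ℝ ∞ f) (p : P) :
    ContDiff ℝ ∞ (fun ζ => f (p, ζ)) :=
  hf.comp (contDiff_const.prodMk contDiff_id)

/-- A smooth function which agrees with `t⁻¹` away from a neighbourhood of `0`. -/
theorem exists_contDiff_mul_eq_one {c : ℝ} (hc : 0 < c) :
    ∃ ρ : ℝ → ℝ, ContDiff ℝ ∞ ρ ∧ ∀ t, c ≤ |t| → ρ t * t = 1 := by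
  let β : ContDiffBump (0 : ℝ) := ⟨c / 2, c, by positivity, by linarith⟩
  have hpos : ∀ t : ℝ, 0 < t ^ 2 + β t := fun t => by
    by_cases ht : t = 0
    · subst ht
      have : β 0 = 1 := β.one_of_mem_closedBall (Metric.mem_closedBall_self (by positivity))
      rw [this]; norm_num
    · have := sq_pos_of_ne_zero ht
      have := β.nonneg (x := t)
      linarith
  -- The bump keeps the denominator positive at `0` and vanishes for `|t| ≥ c`, where the quotient
  -- is exactly `t⁻¹`.
  refine ⟨fun t => t / (t ^ 2 + β t),
    contDiff_id.div ((contDiff_id.pow 2).add β.contDiff) fun t => (hpos t).ne', fun t ht => ?_⟩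
  have h0 : β t = 0 := β.zero_of_le_dist (by simpa [Real.dist_eq] using ht)
  have ht0 : t ≠ 0 := by rintro rfl; simp at ht; linarith
  simp only [h0]
  field_simp
  ring

variable [FiniteDimensional ℝ E] [MeasurableSpace E] [BorelSpace E] {μ : Measure E}
  [μ.IsAddHaarMeasure]

/-- Nonstationary phase: repeated integration by parts in a direction along which the derivative
of the phase is bounded away from zero. -/
theorem exists_pow_mul_norm_integral_le {Φ : P × E → ℝ} {e : P → E} (hΦ : ContDiff ℝ ∞ Φ)
    (he : ContDiff ℝ ∞ e) {K K' : Set P} (hK : IsCompact K) (hK' : K' ⊆ K) {S : Set E}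
    (hS : IsCompact S) {c : ℝ} (hc : 0 < c)
    (hlow : ∀ p ∈ K', ∀ ζ ∈ S, c ≤ |sndFDeriv Φ (p, ζ) (e p)|) (N : ℕ) :
    ∀ a : P × E → ℂ, ContDiff ℝ ∞ a → (∀ p, ∀ ζ, ζ ∉ S → a (p, ζ) = 0) →
      ∃ C : ℝ, ∀ p ∈ K', ∀ t : ℝ, 0 < t →
        t ^ N * ‖∫ ζ, a (p, ζ) * Complex.exp (Complex.I * (t * Φ (p, ζ) : ℝ)) ∂μ‖ ≤ C := by
  induction N with
  | zero =>
    intro a ha hsupp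
    obtain ⟨C, hC⟩ := (hK.prod hS).exists_bound_of_continuousOn ha.continuous.continuousOn
    refine ⟨∫ ζ in S, C ∂μ, fun p hp t _ => ?_⟩
    rw [pow_zero, one_mul, ← setIntegral_eq_integral_of_forall_compl_eq_zero
      (s := S) (fun ζ hζ => by rw [hsupp p ζ hζ, zero_mul])]
    refine norm_integral_le_of_norm_le (integrableOn_const hS.measure_lt_top.ne) ?_
    filter_upwards [ae_restrict_mem hS.measurableSet] with ζ hζ
    rw [norm_mul, mul_comm Complex.I, Complex.norm_exp_ofReal_mul_I, mul_one]
    exact hC _ ⟨hK' hp, hζ⟩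
  | succ N ih =>
    intro a ha hsupp
    obtain ⟨ρ, hρ, hρ1⟩ := exists_contDiff_mul_eq_one hc
    set D : P × E → ℝ := fun q => sndFDeriv Φ q (e q.1) with hD
    have hDs : ContDiff ℝ ∞ D := hΦ.sndFDeriv.clm_apply (he.comp contDiff_fst)
    -- `b` is the amplitude divided by the directional derivative of the phase, with `ρ` in place of
    -- inversion so that `b` is smooth everywhere. Differentiating the exponential against `b`
    -- returns `a` times `I * t`, so one integration by parts gains one power of `t`.
    set b : P × E → ℂ := fun q => a q * (ρ (D q) : ℝ) with hb
    have hbs : ContDiff ℝ ∞ b := ha.mul (Complex.ofRealCLM.contDiff.comp (hρ.comp hDs))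
    have hb0 : ∀ p, ∀ ζ, ζ ∉ S → b (p, ζ) = 0 := fun p ζ h => by simp [hb, hsupp p ζ h]
    have hcs : ∀ g : E → ℂ, (∀ ζ, ζ ∉ S → g ζ = 0) → HasCompactSupport g := fun g hg =>
      HasCompactSupport.intro hS hg
    have hb0' : ∀ p, ∀ ζ, ζ ∉ S → sndFDeriv b (p, ζ) (e p) = 0 := fun p ζ h => by
      have h1 := hasFDerivAt_sndFDeriv hbs p ζ
      have h2 : (fun ζ => b (p, ζ)) =ᶠ[𝓝 ζ] fun _ => 0 := by
        filter_upwards [hS.isClosed.isOpen_compl.mem_nhds h] with x hx using hb0 p x hx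
      have h3 := (hasFDerivAt_const (𝕜 := ℝ) (0 : ℂ) ζ).congr_of_eventuallyEq h2
      rw [h1.unique h3]; simp
    obtain ⟨C, hC⟩ := ih (fun q => sndFDeriv b q (e q.1))
      (hbs.sndFDeriv.clm_apply (he.comp contDiff_fst)) hb0'
    refine ⟨C, fun p hp t ht => ?_⟩
    refine le_trans (le_of_eq ?_) (hC p hp t ht)
    rw [pow_succ, mul_assoc]
    congr 1
    set X : E → ℂ := fun ζ => Complex.exp (Complex.I * (t * Φ (p, ζ) : ℝ)) with hX
    have hXs : ContDiff ℝ ∞ X := by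
      have := hΦ.comp_prodMk_right p
      exact (contDiff_const.mul (Complex.ofRealCLM.contDiff.comp
        (contDiff_const.mul this))).cexp
    have hbp := hbs.comp_prodMk_right p
    have hXd : ∀ ζ v, fderiv ℝ X ζ v =
        X ζ * (Complex.I * (t * sndFDeriv Φ (p, ζ) v : ℝ)) := fun ζ v => by
      have h1 := (Complex.ofRealCLM.hasFDerivAt.comp ζ
        ((hasFDerivAt_sndFDeriv hΦ p ζ).const_mul t)).const_mul Complex.I
      rw [(h1.cexp (f := fun ζ => Complex.I * (t * Φ (p, ζ) : ℝ))).fderiv]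
      simp [hX]
    have hbd : ∀ ζ, fderiv ℝ (fun ζ => b (p, ζ)) ζ = sndFDeriv b (p, ζ) := fun ζ =>
      (hasFDerivAt_sndFDeriv hbs p ζ).fderiv
    have hibp := integral_mul_fderiv_eq_neg_fderiv_mul_of_integrable (μ := μ) (𝕜 := ℂ)
      (f := fun ζ => b (p, ζ)) (g := X) (v := e p) ?_ ?_ ?_
      (fun x _ => hbp.differentiable (by simp) x) (fun x _ => hXs.differentiable (by simp) x)
    · simp only [hbd] at hibp
      simp only [hX] at hibp ⊢
      rw [← norm_neg (∫ ζ, sndFDeriv b (p, ζ) (e p) * _ ∂μ), ← hibp]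
      have : ∀ ζ, b (p, ζ) * fderiv ℝ X ζ (e p) =
          (Complex.I * t) * (a (p, ζ) * Complex.exp (Complex.I * (t * Φ (p, ζ) : ℝ))) := by
        intro ζ
        by_cases hζ : ζ ∈ S
        · rw [hXd]
          have := hρ1 _ (hlow p hp ζ hζ)
          have h2 : ((ρ (D (p, ζ)) : ℝ) : ℂ) * ((sndFDeriv Φ (p, ζ) (e p) : ℝ) : ℂ) = 1 := by
            rw [← Complex.ofReal_mul]; exact_mod_cast this
          simp only [hb, hX]
          push_cast
          linear_combination (Complex.I * t * a (p, ζ) *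
            Complex.exp (Complex.I * (t * Φ (p, ζ)))) * h2
        · rw [hb0 p ζ hζ, hsupp p ζ hζ]; simp
      rw [integral_congr_ae (Filter.Eventually.of_forall this), integral_const_mul, norm_mul]
      simp [abs_of_pos ht]
    · refine Continuous.integrable_of_hasCompactSupport
        (((hbp.continuous_fderiv (by simp)).clm_apply continuous_const).mul hXs.continuous)
        (hcs _ fun ζ h => ?_)
      rw [hbd, hb0' p ζ h, zero_mul]
    · refine Continuous.integrable_of_hasCompactSupport
        (hbp.continuous.mul ((hXs.continuous_fderiv (by simp)).clm_apply continuous_const))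
        (hcs _ fun ζ h => ?_)
      rw [hb0 p ζ h, zero_mul]
    · refine Continuous.integrable_of_hasCompactSupport
        (hbp.continuous.mul hXs.continuous) (hcs _ fun ζ h => ?_)
      rw [hb0 p ζ h, zero_mul]

open Convolution in
/-- Smooth dependence of an integral over `[0, 1]` on parameters. -/
theorem ContDiff.setIntegral_Icc_zero_one [CompleteSpace F] {H : P × ℝ → F}
    (hH : ContDiff ℝ ∞ H) :
    ContDiff ℝ ∞ (fun p => ∫ t in Set.Icc (0 : ℝ) 1, H (p, t)) := by
  let β : ContDiffBump (0 : ℝ) := ⟨1, 2, by norm_num, by norm_num⟩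
  -- The integral is the value at `0` of the convolution of the indicator of `[0, 1]` with `g p`.
  -- The bump gives `g` compact support in `x` and equals `1` at the points `-t` with `t ∈ [0, 1]`.
  let g : P → ℝ → F := fun p x => β x • H (p, -x)
  have hg : ContDiff ℝ ∞ (Function.uncurry g) :=
    (β.contDiff.comp contDiff_snd).smul
      (hH.comp (contDiff_fst.prodMk contDiff_snd.neg))
  have hf : LocallyIntegrable ((Set.Icc (0 : ℝ) 1).indicator fun _ => (1 : ℝ)) volume :=
    (locallyIntegrable_const 1).indicator measurableSet_Icc
  have := contDiffOn_convolution_right_with_param (n := ⊤) (ContinuousLinearMap.lsmul ℝ ℝ)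
    (s := Set.univ) (k := Metric.closedBall (0 : ℝ) 2) isOpen_univ (isCompact_closedBall _ _)
    (g := g) (fun p x _ hx => by
      have : β x = 0 := β.zero_of_le_dist (not_le.1 hx).le
      simp [g, this]) hf (by simpa using! hg.contDiffOn)
  have h2 : ContDiff ℝ ∞ (fun q : P × ℝ => ((Set.Icc (0 : ℝ) 1).indicator (fun _ => (1 : ℝ))
      ⋆[ContinuousLinearMap.lsmul ℝ ℝ, volume] g q.1) q.2) := by
    rw [← contDiffOn_univ]; simpa using! this
  have h3 := h2.comp (contDiff_id.prodMk (contDiff_const (c := (0 : ℝ))))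
  convert! h3 using 2 with p
  simp only [convolution, Function.comp, id]
  rw [← integral_indicator measurableSet_Icc]
  refine integral_congr_ae (Filter.Eventually.of_forall fun t => ?_)
  by_cases ht : t ∈ Set.Icc (0 : ℝ) 1
  · have : β (0 - t) = 1 := β.one_of_mem_closedBall (by
      simpa [abs_le] using ⟨by linarith [ht.1], ht.2⟩)
    simp only [Set.indicator_of_mem ht, g, this]
    simp
  · simp [Set.indicator_of_notMem ht]

end OscillatoryIntegrals

/-! ### Decay of oscillatory integrals near one point -/

section StationaryPhase

open Module

variable {W E : Type*} [NormedAddCommGroup W] [NormedSpace ℝ W]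
  [NormedAddCommGroup E] [NormedSpace ℝ E]

/-- The difference quotient `(G (p, ζ + r θ) - G (p, ζ)) / r` of a phase, as a smooth function of
all its arguments; `e` is a dummy parameter. -/
noncomputable def phaseQuotient (G : W × E → ℝ) (q : (W × ℝ × E × E) × E) : ℝ :=
  ∫ s in Set.Icc (0 : ℝ) 1, sndFDeriv G (q.1.1, q.2 + (s * q.1.2.1) • q.1.2.2.1) q.1.2.2.1

theorem contDiff_phaseQuotient {G : W × E → ℝ} (hG : ContDiff ℝ ∞ G) :
    ContDiff ℝ ∞ (phaseQuotient G) := by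
  refine ContDiff.setIntegral_Icc_zero_one
    (H := fun z : ((W × ℝ × E × E) × E) × ℝ =>
      sndFDeriv G (z.1.1.1, z.1.2 + (z.2 * z.1.1.2.1) • z.1.1.2.2.1) z.1.1.2.2.1) ?_
  exact (hG.sndFDeriv.comp (by fun_prop)).clm_apply (by fun_prop)

/-- Fundamental theorem of calculus along the segment from `ζ` to `ζ + r • θ`. The integral form
keeps the quotient smooth up to `r = 0`, so the constants obtained from compactness do not
degenerate for small shifts. -/
theorem mul_phaseQuotient {G : W × E → ℝ} (hG : ContDiff ℝ ∞ G) (p : W) (r : ℝ) (θ e ζ : E) :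
    r * phaseQuotient G ((p, r, θ, e), ζ) = G (p, ζ + r • θ) - G (p, ζ) := by
  have hd : ∀ s : ℝ, HasDerivAt (fun s : ℝ => G (p, ζ + (s * r) • θ))
      (r * sndFDeriv G (p, ζ + (s * r) • θ) θ) s := fun s => by
    have h1 : HasDerivAt (fun s : ℝ => ζ + (s * r) • θ) ((1 * r) • θ) s :=
      (((hasDerivAt_id s).mul_const r).smul_const θ).const_add ζ
    have := (hasFDerivAt_sndFDeriv hG p (ζ + (s * r) • θ)).comp_hasDerivAt s h1
    simpa using! this
  have hc : Continuous fun s : ℝ => r * sndFDeriv G (p, ζ + (s * r) • θ) θ :=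
    continuous_const.mul ((hG.sndFDeriv.continuous.comp (by fun_prop)).clm_apply
      continuous_const)
  have := intervalIntegral.integral_eq_sub_of_hasDerivAt (fun s _ => hd s)
    (hc.intervalIntegrable 0 1)
  rw [intervalIntegral.integral_const_mul, intervalIntegral.integral_of_le zero_le_one,
    ← integral_Icc_eq_integral_Ioc] at this
  simpa [phaseQuotient] using this

/-- Differentiating `mul_phaseQuotient` in `ζ` expresses the gradient of the quotient as a
difference quotient of gradients. This is how a lower bound on the Hessian becomes nonstationarity
of the quotient. -/
theorem mul_sndFDeriv_phaseQuotient {G : W × E → ℝ} (hG : ContDiff ℝ ∞ G) (p : W) (r : ℝ)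
    (θ e ζ : E) :
    r • sndFDeriv (phaseQuotient G) ((p, r, θ, e), ζ) =
      sndFDeriv G (p, ζ + r • θ) - sndFDeriv G (p, ζ) := by
  have h1 := (hasFDerivAt_sndFDeriv (contDiff_phaseQuotient hG) (p, r, θ, e) ζ).const_mul r
  simp only [mul_phaseQuotient hG] at h1
  refine h1.unique (HasFDerivAt.sub ?_ (hasFDerivAt_sndFDeriv hG p ζ))
  exact (hasFDerivAt_comp_add_right (f := fun ζ => G (p, ζ)) (r • θ)).2
    (hasFDerivAt_sndFDeriv hG p (ζ + r • θ))

variable [MeasurableSpace E]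

/-- The oscillatory integrals with amplitude `a` and phases `G (p, ·)`, `p ∈ s`, have the optimal
decay `t ^ (-n / 2)`. -/
def HasOscillatoryDecay (μ : Measure E) (G : W × E → ℝ) (a : E → ℂ) (s : Set W) : Prop :=
  ∃ C : ℝ, ∀ p ∈ s, ∀ t : ℝ, 0 < t →
    t ^ finrank ℝ E * ‖∫ ζ, a ζ * Complex.exp (Complex.I * (t * G (p, ζ) : ℝ)) ∂μ‖ ^ 2 ≤ C

variable [FiniteDimensional ℝ W] [FiniteDimensional ℝ E] [BorelSpace E] {μ : Measure E}
  [μ.IsAddHaarMeasure]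

/-- Some directional derivative stays away from `0` nearby, so nonstationary phase applies to every
order. The squared norm is split: order `finrank ℝ E` bounds one factor and order `0` the other. -/
theorem hasOscillatoryDecay_of_sndFDeriv_ne_zero {G : W × E → ℝ} (hG : ContDiff ℝ ∞ G) {p₀ : W}
    {ζ₀ : E} {e : E} (he : sndFDeriv G (p₀, ζ₀) e ≠ 0) :
    ∃ δ > 0, ∀ a : E → ℂ, ContDiff ℝ ∞ a → tsupport a ⊆ Metric.ball ζ₀ δ →
      HasOscillatoryDecay μ G a (Metric.ball p₀ δ) := by
  have hcont : Continuous fun q => |sndFDeriv G q e| :=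
    (hG.sndFDeriv.continuous.clm_apply continuous_const).abs
  have hpos := abs_pos.2 he
  obtain ⟨ε, hε, hball⟩ := Metric.eventually_nhds_iff_ball.1
    (hcont.continuousAt.eventually (lt_mem_nhds (half_lt_self hpos)))
  refine ⟨ε / 2, half_pos hε, fun a ha hsupp => ?_⟩
  have key := fun N => exists_pow_mul_norm_integral_le (μ := μ) hG (contDiff_const (c := e))
    (isCompact_closedBall p₀ (ε / 2)) subset_rfl (isCompact_closedBall ζ₀ (ε / 2))
    (half_pos hpos) (fun p hp ζ hζ => (hball (p, ζ) (by
      rw [← ball_prod_same]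
      exact ⟨Metric.closedBall_subset_ball (half_lt_self hε) hp,
        Metric.closedBall_subset_ball (half_lt_self hε) hζ⟩)).le) N
    (fun q => a q.2) (ha.comp contDiff_snd) (fun p ζ hζ =>
      image_eq_zero_of_notMem_tsupport fun h => hζ (Metric.ball_subset_closedBall (hsupp h)))
  obtain ⟨C₀, hC₀⟩ := key 0
  obtain ⟨C₁, hC₁⟩ := key (finrank ℝ E)
  refine ⟨C₁ * C₀, fun p hp t ht => ?_⟩
  have hp' := Metric.ball_subset_closedBall hp
  have h0 := hC₀ p hp' t ht
  have h1 := hC₁ p hp' t ht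
  rw [pow_zero, one_mul] at h0
  rw [sq, ← mul_assoc]
  exact mul_le_mul h1 h0 (norm_nonneg _) ((by positivity : (0 : ℝ) ≤ _).trans h1)

-- The autocorrelation is the convolution of `f` with its reflected conjugate. The integral of a
-- convolution is the product of the integrals, here `|∫ f|²`.
open Convolution ComplexConjugate in
theorem norm_sq_integral_le_integral_norm_autocorrelation {f : E → ℂ} (hf : Integrable f μ) :
    ‖∫ ζ, f ζ ∂μ‖ ^ 2 ≤ ∫ v, ‖∫ ζ, conj (f ζ) * f (ζ + v) ∂μ‖ ∂μ := by
  have hf' : Integrable (fun s => conj (f (-s))) μ :=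
    (Complex.conjLIE.toContinuousLinearEquiv.toContinuousLinearMap.integrable_comp hf).comp_neg
  have h := integral_convolution (μ := μ) (ν := μ) (ContinuousLinearMap.mul ℝ ℂ) hf' hf
  have h2 : ∀ v, ((fun s => conj (f (-s))) ⋆[ContinuousLinearMap.mul ℝ ℂ, μ] f) v =
      ∫ ζ, conj (f ζ) * f (ζ + v) ∂μ := fun v => by
    rw [convolution, ← integral_neg_eq_self]
    simp [add_comm]
  simp only [h2] at h
  have h3 : ∫ s, conj (f (-s)) ∂μ = conj (∫ ζ, f ζ ∂μ) := by
    rw [integral_neg_eq_self (fun s => conj (f s)), integral_conj]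
  calc ‖∫ ζ, f ζ ∂μ‖ ^ 2 = ‖∫ v, ∫ ζ, conj (f ζ) * f (ζ + v) ∂μ ∂μ‖ := by
        rw [h, h3]; simp [sq]
    _ ≤ _ := norm_integral_le_integral_norm _

theorem integral_one_add_mul_norm {t : ℝ} (ht : 0 < t) (r : ℝ) :
    ∫ v : E, (1 + t * ‖v‖) ^ r ∂μ = (t ^ finrank ℝ E)⁻¹ * ∫ v : E, (1 + ‖v‖) ^ r ∂μ := by
  have := Measure.integral_comp_smul μ (fun v : E => (1 + ‖v‖) ^ r) t
  simpa [norm_smul, abs_of_pos ht] using this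

-- The squaring argument: the autocorrelation at shift `v` is an oscillatory integral with large
-- parameter `t * ‖v‖` and phase `phaseQuotient`. Its phase has no critical point on the support of
-- `a` when `v` is small, and its integrand vanishes when `v` is large. Integrating the bound `(1 +
-- t‖v‖)^(-(n + 1))` over `v` gives `t^(-n)` by scaling, where `n = finrank ℝ E`.
open ComplexConjugate in
theorem hasOscillatoryDecay_of_hessian_injective {G : W × E → ℝ} (hG : ContDiff ℝ ∞ G) {p₀ : W}
    {ζ₀ : E} (hinj : ∀ v, sndFDeriv (sndFDeriv G) (p₀, ζ₀) v = 0 → v = 0) :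
    ∃ δ > 0, ∀ a : E → ℂ, ContDiff ℝ ∞ a → tsupport a ⊆ Metric.ball ζ₀ δ →
      HasOscillatoryDecay μ G a (Metric.ball p₀ δ) := by
  set H := sndFDeriv (sndFDeriv G) with hH
  have hHc : Continuous H := hG.sndFDeriv.sndFDeriv.continuous
  obtain ⟨κ, hκ, hanti⟩ := (H (p₀, ζ₀)).toLinearMap.exists_antilipschitzWith
    (LinearMap.ker_eq_bot'.2 hinj)
  have hanti' : ∀ v, ‖v‖ ≤ κ * ‖H (p₀, ζ₀) v‖ := fun v => by
    simpa using! hanti.le_mul_dist v 0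
  -- Unit vectors have image of norm at least `κ⁻¹` under the Hessian at the base point. Half of
  -- this leaves room to choose a direction `e` with a strict inequality.
  set c : ℝ := (2 * κ)⁻¹ with hc
  have hκ' : (0 : ℝ) < κ := hκ
  have hcpos : 0 < c := by positivity
  obtain ⟨ε, hε, hball⟩ := Metric.eventually_nhds_iff_ball.1
    (hHc.continuousAt.eventually (Metric.ball_mem_nhds (H (p₀, ζ₀)) (half_pos hcpos)))
  -- For `ζ` within `δ` of `ζ₀` and `r ≤ 2δ`, the shifted point stays within `3δ < ε`.
  set δ := ε / 4 with hδ
  have hδpos : 0 < δ := by positivity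
  refine ⟨δ, hδpos, fun a ha hsupp => ?_⟩
  have hsupp0 : ∀ ζ, ζ ∉ Metric.closedBall ζ₀ δ → a ζ = 0 := fun ζ hζ =>
    image_eq_zero_of_notMem_tsupport fun h => hζ (Metric.ball_subset_closedBall (hsupp h))
  have hacs : HasCompactSupport a := HasCompactSupport.intro (isCompact_closedBall ζ₀ δ) hsupp0
  -- The shift is written in polar form `v = r • θ`, and `e` is a direction in which the functional
  -- `H (p₀, ζ₀) θ` is large. The value `r = 0` is excluded since the lower bound is obtained by
  -- dividing by `r`.
  set K' : Set (W × ℝ × E × E) := {q | q.1 ∈ Metric.closedBall p₀ δ ∧ q.2.1 ∈ Set.Ioc 0 (2 * δ) ∧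
    ‖q.2.2.1‖ = 1 ∧ ‖q.2.2.2‖ ≤ 1 ∧ c ≤ |H (p₀, ζ₀) q.2.2.1 q.2.2.2|} with hK'
  have hlow : ∀ q ∈ K', ∀ ζ ∈ Metric.closedBall ζ₀ δ,
      c / 2 ≤ |sndFDeriv (phaseQuotient G) (q, ζ) q.2.2.2| := by
    rintro ⟨p, r, θ, e⟩ ⟨hp, hr, hθ, he, hce⟩ ζ hζ
    simp only at hp hr hθ he hce ⊢
    have hmem : ζ + r • θ ∈ Metric.ball ζ₀ ε := by
      rw [Metric.mem_ball, dist_eq_norm]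
      rw [Metric.mem_closedBall, dist_eq_norm] at hζ
      have : ‖ζ + r • θ - ζ₀‖ ≤ ‖ζ - ζ₀‖ + ‖r • θ‖ := by
        rw [add_sub_right_comm]; exact norm_add_le _ _
      rw [norm_smul, hθ, Real.norm_eq_abs, abs_of_pos hr.1] at this
      linarith [hr.2]
    -- The Hessian varies by at most `c / 2` on the ball. The gradient therefore changes along `r •
    -- θ` by `r` times `H (p₀, ζ₀) θ`, up to an error `r * c / 2`.
    have hmvt := (convex_ball ζ₀ ε).norm_image_sub_le_of_norm_hasFDerivWithin_le'
      (f := fun ζ => sndFDeriv G (p, ζ)) (φ := H (p₀, ζ₀)) (C := c / 2)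
      (fun x _ => (hasFDerivAt_sndFDeriv hG.sndFDeriv p x).hasFDerivWithinAt)
      (fun x hx => by
        have := hball (p, x) (by
          rw [← ball_prod_same]
          exact ⟨Metric.closedBall_subset_ball (by linarith) hp, hx⟩)
        rw [← dist_eq_norm]; exact (Metric.mem_ball.1 this).le)
      (Metric.closedBall_subset_ball (by linarith) hζ) hmem
    rw [← mul_sndFDeriv_phaseQuotient hG p r θ e ζ, add_sub_cancel_left, map_smul, ← smul_sub,
      norm_smul, norm_smul, hθ, Real.norm_eq_abs, abs_of_pos hr.1, mul_one,
      mul_comm (c / 2)] at hmvt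
    have hmvt' := le_of_mul_le_mul_left hmvt hr.1
    have h4 := ContinuousLinearMap.le_of_opNorm_le _ hmvt' e
    rw [sub_apply, Real.norm_eq_abs] at h4
    have h5 : c / 2 * ‖e‖ ≤ c / 2 := mul_le_of_le_one_right (by positivity) he
    have h6 := abs_sub_abs_le_abs_sub (H (p₀, ζ₀) θ e)
      (sndFDeriv (phaseQuotient G) ((p, r, θ, e), ζ) e)
    rw [abs_sub_comm] at h6
    linarith
  -- One order more than the dimension makes the resulting bound integrable in `v`.
  obtain ⟨C, hC⟩ := exists_pow_mul_norm_integral_le (μ := μ) (contDiff_phaseQuotient hG)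
    (e := fun q : W × ℝ × E × E => q.2.2.2) (by fun_prop)
    (K := Metric.closedBall p₀ δ ×ˢ Set.Icc 0 (2 * δ) ×ˢ Metric.closedBall (0 : E) 1 ×ˢ
      Metric.closedBall (0 : E) 1) (K' := K')
    ((isCompact_closedBall _ _).prod (isCompact_Icc.prod
      ((isCompact_closedBall _ _).prod (isCompact_closedBall _ _))))
    (by
      rintro ⟨p, r, θ, e⟩ ⟨hp, hr, hθ, he, -⟩
      exact ⟨hp, Set.Ioc_subset_Icc_self hr, by simpa using! hθ.le, by simpa using! he⟩)
    (isCompact_closedBall ζ₀ δ) (half_pos hcpos) hlow (finrank ℝ E + 1)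
    (fun q => conj (a q.2) * a (q.2 + q.1.2.1 • q.1.2.2.1))
    ((Complex.conjCLE.contDiff.comp (ha.comp contDiff_snd)).mul (ha.comp (by fun_prop)))
    (fun q ζ hζ => by simp [hsupp0 ζ hζ])
  obtain ⟨B, hB⟩ := hacs.exists_bound_of_continuous ha.continuous
  have hB0 : 0 ≤ B := (norm_nonneg _).trans (hB 0)
  have hai : Integrable a μ := ha.continuous.integrable_of_hasCompactSupport hacs
  set M : ℝ := B * ∫ ζ, ‖a ζ‖ ∂μ with hM
  set I₀ := ∫ v : E, (1 + ‖v‖) ^ (-((finrank ℝ E : ℝ) + 1)) ∂μ with hI₀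
  set D : ℝ := 2 ^ (finrank ℝ E + 1) * (M + max C 0) with hD
  refine ⟨D * I₀, fun p hp t ht => ?_⟩
  set f : E → ℂ := fun ζ => a ζ * Complex.exp (Complex.I * (t * G (p, ζ) : ℝ)) with hf
  have hGp := (hG.comp_prodMk_right p).continuous
  have hnf : ∀ ζ, ‖f ζ‖ = ‖a ζ‖ := fun ζ => by
    rw [hf]; simp only [norm_mul]
    rw [mul_comm Complex.I, Complex.norm_exp_ofReal_mul_I, mul_one]
  have hfc : Continuous f := ha.continuous.mul (by fun_prop)
  have hfi : Integrable f μ := hai.mono hfc.aestronglyMeasurable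
    (Filter.Eventually.of_forall fun ζ => (hnf ζ).le)
  set J : E → ℝ := fun v => ‖∫ ζ, conj (f ζ) * f (ζ + v) ∂μ‖ with hJ
  have hJM : ∀ v, J v ≤ M := fun v => by
    rw [hM, ← integral_const_mul]
    refine norm_integral_le_of_norm_le (hai.norm.const_mul B)
      (Filter.Eventually.of_forall fun ζ => ?_)
    rw [norm_mul, RCLike.norm_conj, hnf, hnf, mul_comm]
    exact mul_le_mul_of_nonneg_right (hB _) (norm_nonneg _)
  have hJC : ∀ v, (t * ‖v‖) ^ (finrank ℝ E + 1) * J v ≤ max C 0 := fun v => by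
    rcases eq_or_ne v 0 with rfl | hv
    · simp
    have hvpos : 0 < ‖v‖ := norm_pos_iff.2 hv
    rcases le_or_gt ‖v‖ (2 * δ) with hle | hgt
    · set θ : E := ‖v‖⁻¹ • v with hθ
      have hθ1 : ‖θ‖ = 1 := norm_smul_inv_norm (𝕜 := ℝ) hv
      have hrθ : ‖v‖ • θ = v := by rw [hθ, smul_smul, mul_inv_cancel₀ hvpos.ne', one_smul]
      have hge : c < ‖H (p₀, ζ₀) θ‖ := by
        have := hanti' θ
        rw [hθ1] at this
        rw [hc, inv_lt_iff_one_lt_mul₀ (by positivity)]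
        linarith
      obtain ⟨e, he1, he2⟩ := (H (p₀, ζ₀) θ).exists_lt_apply_of_lt_opNorm hge
      refine le_trans ?_ (le_max_left _ _)
      refine le_trans (le_of_eq ?_) (hC (p, ‖v‖, θ, e) ⟨Metric.ball_subset_closedBall hp,
        ⟨hvpos, hle⟩, hθ1, he1.le, by simpa using! he2.le⟩ (t * ‖v‖) (by positivity))
      refine congrArg₂ _ rfl (congrArg norm
        (integral_congr_ae (Filter.Eventually.of_forall fun ζ => ?_)))
      -- The phases of `conj (f ζ)` and `f (ζ + v)` combine to `t * (G (p, ζ + v) - G (p, ζ))`,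
      -- which is `t * ‖v‖` times the quotient.
      simp only [hf, hrθ, mul_assoc t, mul_phaseQuotient hG]
      rw [map_mul, ← Complex.exp_conj, mul_mul_mul_comm, ← Complex.exp_add]
      congr 2
      simp only [map_mul, Complex.conj_I, Complex.conj_ofReal]
      push_cast
      ring
    -- A shift longer than the diameter bound `2δ` of the support makes the two factors have
    -- disjoint supports.
    · have : J v = 0 := by
        rw [hJ]
        refine norm_eq_zero.2 ?_
        refine integral_eq_zero_of_ae (Filter.Eventually.of_forall fun ζ => ?_)
        by_cases h1 : ζ ∈ Metric.closedBall ζ₀ δ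
        · have h2 : ζ + v ∉ Metric.closedBall ζ₀ δ := fun h2 => by
            rw [Metric.mem_closedBall] at h1 h2
            have := dist_triangle_right (ζ + v) ζ ζ₀
            rw [dist_eq_norm, add_sub_cancel_left] at this
            linarith
          simp [hf, hsupp0 _ h2]
        · simp [hf, hsupp0 _ h1]
      rw [this, mul_zero]; exact le_max_right _ _
  have hJD : ∀ v, J v ≤ D * (1 + t * ‖v‖) ^ (-((finrank ℝ E : ℝ) + 1)) := fun v => by
    have hs : 0 ≤ t * ‖v‖ := by positivity
    have h1 := add_pow_le zero_le_one hs (finrank ℝ E + 1)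
    have hJ0 : 0 ≤ J v := norm_nonneg _
    rw [Real.rpow_neg (by positivity), ← div_eq_mul_inv, le_div_iff₀ (by positivity)]
    have h3 : (1 + t * ‖v‖) ^ ((finrank ℝ E : ℝ) + 1) = (1 + t * ‖v‖) ^ (finrank ℝ E + 1) := by
      rw [← Real.rpow_natCast]; push_cast; rfl
    rw [h3]
    calc J v * (1 + t * ‖v‖) ^ (finrank ℝ E + 1)
        ≤ J v * (2 ^ (finrank ℝ E + 1) * (1 + (t * ‖v‖) ^ (finrank ℝ E + 1))) := by
          refine mul_le_mul_of_nonneg_left (h1.trans ?_) hJ0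
          rw [one_pow]
          gcongr
          · norm_num
          · omega
      _ = 2 ^ (finrank ℝ E + 1) * (J v + (t * ‖v‖) ^ (finrank ℝ E + 1) * J v) := by ring
      _ ≤ D := by rw [hD]; gcongr; exacts [hJM v, hJC v]
  have hint : Integrable (fun v : E => (1 + t * ‖v‖) ^ (-((finrank ℝ E : ℝ) + 1))) μ := by
    have := (integrable_one_add_norm (E := E) (μ := μ)
      (r := (finrank ℝ E : ℝ) + 1) (by linarith)).comp_smul ht.ne'
    simpa [norm_smul, abs_of_pos ht] using this
  have hmain : ‖∫ ζ, f ζ ∂μ‖ ^ 2 ≤ D * ((t ^ finrank ℝ E)⁻¹ * I₀) := by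
    rw [hI₀, ← integral_one_add_mul_norm ht, ← integral_const_mul]
    exact (norm_sq_integral_le_integral_norm_autocorrelation hfi).trans
      (integral_mono_of_nonneg (Filter.Eventually.of_forall fun v => norm_nonneg _)
        (hint.const_mul D) (Filter.Eventually.of_forall hJD))
  calc t ^ finrank ℝ E * ‖∫ ζ, f ζ ∂μ‖ ^ 2
      ≤ t ^ finrank ℝ E * (D * ((t ^ finrank ℝ E)⁻¹ * I₀)) := by gcongr
    _ = D * I₀ := by field_simp

end StationaryPhase

/-! ### From local decay to compact supports and compact parameter sets -/

section Localization

set_option linter.unusedSectionVars false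

open Module Manifold

variable {W E : Type*} [NormedAddCommGroup W] [NormedSpace ℝ W]
  [NormedAddCommGroup E] [NormedSpace ℝ E] [MeasurableSpace E]

/-- At `q`, the phase is not stationary in the second variable, or its Hessian is nondegenerate. -/
def IsNondegenerateAt (G : W × E → ℝ) (q : W × E) : Prop :=
  sndFDeriv G q ≠ 0 ∨ ∀ v, sndFDeriv (sndFDeriv G) q v = 0 → v = 0

theorem HasOscillatoryDecay.mono {μ : Measure E} {G : W × E → ℝ} {a : E → ℂ} {s t : Set W}
    (h : HasOscillatoryDecay μ G a t) (hst : s ⊆ t) : HasOscillatoryDecay μ G a s :=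
  let ⟨C, hC⟩ := h
  ⟨C, fun p hp => hC p (hst hp)⟩

theorem HasOscillatoryDecay.union {μ : Measure E} {G : W × E → ℝ} {a : E → ℂ} {s t : Set W}
    (hs : HasOscillatoryDecay μ G a s) (ht : HasOscillatoryDecay μ G a t) :
    HasOscillatoryDecay μ G a (s ∪ t) := by
  obtain ⟨C, hC⟩ := hs
  obtain ⟨D, hD⟩ := ht
  refine ⟨max C D, fun p hp τ hτ => ?_⟩
  rcases hp with hp | hp
  · exact (hC p hp τ hτ).trans (le_max_left _ _)
  · exact (hD p hp τ hτ).trans (le_max_right _ _)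

variable [FiniteDimensional ℝ E] [BorelSpace E] {μ : Measure E} [μ.IsAddHaarMeasure]

theorem HasOscillatoryDecay.sum {ι : Type*} {G : W × E → ℝ} (hG : ContDiff ℝ ∞ G)
    {a : ι → E → ℂ} {s : Set W} (t : Finset ι) (hint : ∀ i ∈ t, Integrable (a i) μ)
    (h : ∀ i ∈ t, HasOscillatoryDecay μ G (a i) s) :
    HasOscillatoryDecay μ G (fun ζ => ∑ i ∈ t, a i ζ) s := by
  choose! C hC using h
  refine ⟨t.card * ∑ i ∈ t, C i, fun p hp τ hτ => ?_⟩
  have hint' : ∀ i ∈ t, Integrable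
      (fun ζ => a i ζ * Complex.exp (Complex.I * (τ * G (p, ζ) : ℝ))) μ := fun i hi => by
    have hc : Continuous fun ζ => Complex.exp (Complex.I * (τ * G (p, ζ) : ℝ)) := by
      have := (hG.comp_prodMk_right p).continuous
      fun_prop
    refine (hint i hi).mono ((hint i hi).aestronglyMeasurable.mul hc.aestronglyMeasurable)
      (Filter.Eventually.of_forall fun ζ => ?_)
    rw [norm_mul, mul_comm Complex.I, Complex.norm_exp_ofReal_mul_I, mul_one]
  simp only [Finset.sum_mul]
  rw [integral_finsetSum _ hint']
  calc τ ^ finrank ℝ E * ‖∑ i ∈ t, ∫ ζ, a i ζ * Complex.exp (Complex.I * (τ * G (p, ζ) : ℝ)) ∂μ‖ ^ 2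
      ≤ τ ^ finrank ℝ E * (t.card * ∑ i ∈ t,
        ‖∫ ζ, a i ζ * Complex.exp (Complex.I * (τ * G (p, ζ) : ℝ)) ∂μ‖ ^ 2) := by
        gcongr
        exact (pow_le_pow_left₀ (norm_nonneg _) (norm_sum_le _ _) 2).trans
          sq_sum_le_card_mul_sum_sq
    _ = t.card * ∑ i ∈ t, τ ^ finrank ℝ E *
        ‖∫ ζ, a i ζ * Complex.exp (Complex.I * (τ * G (p, ζ) : ℝ)) ∂μ‖ ^ 2 := by
        rw [← Finset.mul_sum]; ring
    _ ≤ _ := by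
        gcongr with i hi
        exact hC i hi p hp τ hτ

variable [FiniteDimensional ℝ W]

/-- Finitely many of the local neighbourhoods cover the support of `ψ`. A partition of unity splits
`ψ` accordingly, and the smallest radius serves as common parameter radius. -/
theorem exists_hasOscillatoryDecay_ball {G : W × E → ℝ} (hG : ContDiff ℝ ∞ G) {ψ : E → ℂ}
    (hψ : ContDiff ℝ ∞ ψ) (hψc : HasCompactSupport ψ) {p₀ : W}
    (hnd : ∀ ζ ∈ tsupport ψ, IsNondegenerateAt G (p₀, ζ)) :
    ∃ δ > 0, HasOscillatoryDecay μ G ψ (Metric.ball p₀ δ) := by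
  have hloc : ∀ ζ ∈ tsupport ψ, ∃ δ > 0, ∀ a : E → ℂ, ContDiff ℝ ∞ a →
      tsupport a ⊆ Metric.ball ζ δ → HasOscillatoryDecay μ G a (Metric.ball p₀ δ) :=
    fun ζ hζ => by
      rcases hnd ζ hζ with h | h
      · obtain ⟨e, he⟩ : ∃ e, sndFDeriv G (p₀, ζ) e ≠ 0 := by
          by_contra! h0
          exact h (ContinuousLinearMap.ext h0)
        exact hasOscillatoryDecay_of_sndFDeriv_ne_zero hG he
      · exact hasOscillatoryDecay_of_hessian_injective hG h
  choose! δ hδ hdec using hloc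
  obtain ⟨t, htK, hcov⟩ := hψc.isCompact.elim_nhds_subcover (fun ζ => Metric.ball ζ (δ ζ))
    (fun ζ hζ => Metric.ball_mem_nhds ζ (hδ ζ hζ))
  obtain ⟨ρ, hρ⟩ := SmoothPartitionOfUnity.exists_isSubordinate 𝓘(ℝ, E) (isClosed_tsupport ψ)
    (fun ζ : t => Metric.ball (ζ : E) (δ ζ)) (fun _ => Metric.isOpen_ball) (fun x hx => by
      obtain ⟨ζ, hζ, hx⟩ := Set.mem_iUnion₂.1 (hcov hx)
      exact Set.mem_iUnion.2 ⟨⟨ζ, hζ⟩, hx⟩)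
  have hsum : ψ = fun ζ => ∑ i : t, (ρ i ζ : ℂ) * ψ ζ := by
    funext ζ
    by_cases hζ : ζ ∈ tsupport ψ
    · have h1 := ρ.sum_eq_one hζ
      rw [finsum_eq_sum_of_fintype] at h1
      rw [← Finset.sum_mul, ← Complex.ofReal_sum, h1]; simp
    · simp [image_eq_zero_of_notMem_tsupport hζ]
  have hsm : ∀ i : t, ContDiff ℝ ∞ fun ζ => (ρ i ζ : ℂ) * ψ ζ := fun i =>
    (Complex.ofRealCLM.contDiff.comp (ρ i).contMDiff.contDiff).mul hψ
  obtain ⟨ε, hε, hεle⟩ : ∃ ε > 0, ∀ i : t, ε ≤ δ i := by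
    rcases isEmpty_or_nonempty t with h | h
    · exact ⟨1, one_pos, fun i => (h.false i).elim⟩
    · obtain ⟨i, hi⟩ := Finite.exists_min fun i : t => δ i
      exact ⟨δ i, hδ _ (htK i i.2), hi⟩
  refine ⟨ε, hε, ?_⟩
  rw [hsum]
  refine HasOscillatoryDecay.sum hG _
    (fun i _ => (hsm i).continuous.integrable_of_hasCompactSupport hψc.mul_left) fun i _ => ?_
  refine (hdec i (htK i i.2) _ (hsm i) ?_).mono (Metric.ball_subset_ball (hεle i))
  refine subset_trans (closure_mono fun ζ hζ => ?_) (hρ i)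
  intro h0
  exact hζ (by simp [h0])

/-- Compactness of `K` makes the constant uniform. The conclusion is on an open neighbourhood so
that it also covers phases slightly perturbed from those in `K`. -/
theorem exists_isOpen_hasOscillatoryDecay {G : W × E → ℝ} (hG : ContDiff ℝ ∞ G) {ψ : E → ℂ}
    (hψ : ContDiff ℝ ∞ ψ) (hψc : HasCompactSupport ψ) {K : Set W} (hK : IsCompact K)
    (hnd : ∀ p ∈ K, ∀ ζ ∈ tsupport ψ, IsNondegenerateAt G (p, ζ)) :
    ∃ O, IsOpen O ∧ K ⊆ O ∧ HasOscillatoryDecay μ G ψ O := by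
  refine hK.induction_on (p := fun s => ∃ O, IsOpen O ∧ s ⊆ O ∧ HasOscillatoryDecay μ G ψ O)
    ⟨∅, isOpen_empty, subset_rfl, 0, fun p hp => hp.elim⟩
    (fun s t hst ⟨O, ho, hO, h⟩ => ⟨O, ho, hst.trans hO, h⟩)
    (fun s t ⟨O, ho, hO, h⟩ ⟨O', ho', hO', h'⟩ =>
      ⟨O ∪ O', ho.union ho', Set.union_subset_union hO hO', h.union h'⟩)
    fun p hp => ?_
  obtain ⟨δ, hδ, h⟩ := exists_hasOscillatoryDecay_ball (μ := μ) hG hψ hψc (hnd p hp)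
  exact ⟨Metric.ball p δ, mem_nhdsWithin_of_mem_nhds (Metric.ball_mem_nhds p hδ),
    Metric.ball p δ, Metric.isOpen_ball, subset_rfl, h⟩

end Localization

/-! ### The Fourier transform of a surface-carried measure -/

section SurfaceMeasure

open Module
open scoped InnerProductSpace

variable {V E : Type*} [NormedAddCommGroup V] [InnerProductSpace ℝ V]
  [NormedAddCommGroup E] [InnerProductSpace ℝ E]

/-- Every unit vector normal to the immersion `γ` at `ζ` has a nondegenerate second fundamental
form. -/
def HasNondegenerateNormals (γ : E → V) (ζ : E) : Prop :=
  ∀ ν : V, ‖ν‖ = 1 → (∀ v, ⟪ν, fderiv ℝ γ ζ v⟫_ℝ = 0) →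
    ∀ v, (∀ w, ⟪ν, fderiv ℝ (fderiv ℝ γ) ζ v w⟫_ℝ = 0) → v = 0

theorem HasNondegenerateNormals.congr {γ γ' : E → V} {ζ : E} (h : HasNondegenerateNormals γ ζ)
    (hγ : γ' =ᶠ[𝓝 ζ] γ) : HasNondegenerateNormals γ' ζ := by
  intro ν hν h1 v h2
  rw [hγ.fderiv_eq] at h1
  rw [hγ.fderiv.fderiv_eq] at h2
  exact h ν hν h1 v h2

/-- The phase `⟪ν, γ ζ⟫_ℝ + ⟪w, ζ⟫_ℝ` with parameters `ν` and `w`. -/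
def surfacePhase (γ : E → V) (q : (V × E) × E) : ℝ := ⟪q.1.1, γ q.2⟫_ℝ + ⟪q.1.2, q.2⟫_ℝ

theorem contDiff_surfacePhase {γ : E → V} (hγ : ContDiff ℝ ∞ γ) :
    ContDiff ℝ ∞ (surfacePhase γ) := by
  exact (contDiff_fst.fst.inner ℝ (hγ.comp contDiff_snd)).add
    (contDiff_fst.snd.inner ℝ contDiff_snd)

theorem sndFDeriv_surfacePhase {γ : E → V} (hγ : ContDiff ℝ ∞ γ) (p : V × E) (ζ : E) :
    sndFDeriv (surfacePhase γ) (p, ζ) =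
      (innerSL ℝ p.1).comp (fderiv ℝ γ ζ) + innerSL ℝ p.2 := by
  refine (hasFDerivAt_sndFDeriv (contDiff_surfacePhase hγ) p ζ).unique ?_
  exact ((innerSL ℝ p.1).hasFDerivAt.comp ζ
    (hγ.differentiable (by simp) ζ).hasFDerivAt).add (innerSL ℝ p.2).hasFDerivAt

theorem sndFDeriv_sndFDeriv_surfacePhase {γ : E → V} (hγ : ContDiff ℝ ∞ γ) (p : V × E)
    (ζ v w : E) : sndFDeriv (sndFDeriv (surfacePhase γ)) (p, ζ) v w =
      ⟪p.1, fderiv ℝ (fderiv ℝ γ) ζ v w⟫_ℝ := by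
  have h1 := (hasFDerivAt_sndFDeriv (contDiff_surfacePhase hγ).sndFDeriv p ζ).clm_apply
    (hasFDerivAt_const w ζ)
  simp only [sndFDeriv_surfacePhase hγ] at h1
  have hγ' : ContDiff ℝ ∞ (fderiv ℝ γ) := hγ.fderiv_right (m := ∞) (by norm_cast)
  have h2 := ((innerSL ℝ p.1).hasFDerivAt.comp ζ
    ((hγ'.differentiable (by simp) ζ).hasFDerivAt.clm_apply (hasFDerivAt_const w ζ))).add_const
      ⟪p.2, w⟫_ℝ
  simpa using congrArg (fun L => L v) (h1.unique h2)

/-- Either `ν` is not normal at `ζ` and the phase is not stationary, or `ν` is normal and the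
Hessian of the phase is the second fundamental form paired with `ν`. -/
theorem isNondegenerateAt_surfacePhase {γ : E → V} (hγ : ContDiff ℝ ∞ γ) {ζ : E}
    (h : HasNondegenerateNormals γ ζ) {ν : V} (hν : ‖ν‖ = 1) :
    IsNondegenerateAt (surfacePhase γ) ((ν, 0), ζ) := by
  by_cases h1 : ∀ v, ⟪ν, fderiv ℝ γ ζ v⟫_ℝ = 0
  · right
    intro v hv
    refine h ν hν h1 v fun w => ?_
    rw [← sndFDeriv_sndFDeriv_surfacePhase hγ (ν, 0), hv]
    rfl
  · left
    push Not at h1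
    obtain ⟨v, hv⟩ := h1
    intro h0
    apply hv
    have := congrArg (fun L => L v) h0
    simpa [sndFDeriv_surfacePhase hγ] using this

variable [FiniteDimensional ℝ E] [MeasurableSpace E] [BorelSpace E]

/-- The Fourier transform of the measure `ψ(ζ) dζ` transported by `ζ ↦ (γ ζ, ζ)`. -/
noncomputable def surfaceKernel (γ : E → V) (ψ : E → ℂ) (x : V) (z : E) : ℂ :=
  ∫ ζ, ψ ζ * Complex.exp (Complex.I * (-(2 * Real.pi * (⟪x, γ ζ⟫_ℝ + ⟪z, ζ⟫_ℝ)) : ℝ))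

theorem norm_surfaceKernel_le (γ : E → V) (ψ : E → ℂ) (x : V) (z : E) :
    ‖surfaceKernel γ ψ x z‖ ≤ ∫ ζ, ‖ψ ζ‖ := by
  refine (norm_integral_le_integral_norm _).trans (le_of_eq ?_)
  congr 1
  funext ζ
  rw [norm_mul, mul_comm Complex.I, Complex.norm_exp_ofReal_mul_I, mul_one]

/-- Dividing the phase by `‖x‖` puts the parameters near the compact set of pairs `(ν, 0)` with `‖ν‖
= 1`, and the large parameter becomes `2π‖x‖`. Small `z/‖x‖` is absorbed by the open neighbourhood
of uniform decay. -/
theorem exists_pow_mul_norm_surfaceKernel_sq_le [FiniteDimensional ℝ V] {γ : E → V} {ψ : E → ℂ}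
    (hγ : ContDiff ℝ ∞ γ) (hψ : ContDiff ℝ ∞ ψ) (hψc : HasCompactSupport ψ)
    (hnd : ∀ ζ ∈ tsupport ψ, HasNondegenerateNormals γ ζ) :
    ∃ δ > 0, ∃ C : ℝ, ∀ x z, ‖z‖ ≤ δ * ‖x‖ →
      ‖x‖ ^ finrank ℝ E * ‖surfaceKernel γ ψ x z‖ ^ 2 ≤ C := by
  have hK : IsCompact (Metric.sphere (0 : V) 1 ×ˢ ({0} : Set E)) :=
    (isCompact_sphere 0 1).prod isCompact_singleton
  obtain ⟨O, hO, hKO, C, hC⟩ := exists_isOpen_hasOscillatoryDecay (μ := (volume : Measure E))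
    (contDiff_surfacePhase hγ) hψ hψc hK (by
      rintro ⟨ν, w⟩ ⟨hν, hw⟩ ζ hζ
      obtain rfl : w = 0 := hw
      exact isNondegenerateAt_surfacePhase hγ (hnd ζ hζ) (by simpa using hν))
  obtain ⟨δ, hδ, hthick⟩ := hK.exists_thickening_subset_open hO hKO
  -- The second entry of the maximum covers `x = 0`, where also `z = 0`; when `E` has dimension `0`
  -- the factor `‖x‖ ^ 0` is `1` there.
  refine ⟨δ / 2, half_pos hδ, max C (‖surfaceKernel γ ψ 0 0‖ ^ 2), fun x z hz => ?_⟩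
  rcases eq_or_ne x 0 with rfl | hx
  · obtain rfl : z = 0 := by simpa using hz
    refine le_max_of_le_right (mul_le_of_le_one_left (by positivity) ?_)
    rw [norm_zero]
    exact pow_le_one₀ le_rfl zero_le_one
  have hxpos : 0 < ‖x‖ := norm_pos_iff.2 hx
  refine le_max_of_le_left ?_
  have hmem : (-(‖x‖⁻¹ • x), -(‖x‖⁻¹ • z)) ∈ O := hthick (Metric.mem_thickening_iff.2
    ⟨(-(‖x‖⁻¹ • x), 0), ⟨by
      simp only [mem_sphere_iff_norm, sub_zero, norm_neg]
      exact norm_smul_inv_norm (𝕜 := ℝ) hx, rfl⟩, by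
      rw [Prod.dist_eq, dist_self, dist_zero_right, norm_neg, norm_smul, norm_inv, norm_norm,
        max_lt_iff]
      refine ⟨hδ, ?_⟩
      rw [inv_mul_lt_iff₀ hxpos]
      nlinarith⟩)
  refine le_trans ?_ (hC _ hmem (2 * Real.pi * ‖x‖) (by positivity))
  have hphase : ∀ ζ, 2 * Real.pi * ‖x‖ *
      surfacePhase γ ((-(‖x‖⁻¹ • x), -(‖x‖⁻¹ • z)), ζ) =
      -(2 * Real.pi * (⟪x, γ ζ⟫_ℝ + ⟪z, ζ⟫_ℝ)) := fun ζ => by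
    simp only [surfacePhase, inner_neg_left, real_inner_smul_left]
    field_simp
    ring
  simp only [hphase]
  refine mul_le_mul_of_nonneg_right (pow_le_pow_left₀ hxpos.le ?_ _) (by positivity)
  nlinarith [Real.pi_gt_three]

theorem continuous_surfaceKernel [FiniteDimensional ℝ V] {γ : E → V} {ψ : E → ℂ}
    (hγ : Continuous γ) (hψ : Continuous ψ) (hψc : HasCompactSupport ψ) :
    Continuous fun q : V × E => surfaceKernel γ ψ q.1 q.2 := by
  have : ∀ q : V × E, surfaceKernel γ ψ q.1 q.2 = ∫ ζ in tsupport ψ,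
      ψ ζ * Complex.exp (Complex.I * (-(2 * Real.pi * (⟪q.1, γ ζ⟫_ℝ + ⟪q.2, ζ⟫_ℝ)) : ℝ)) := fun q =>
    (setIntegral_eq_integral_of_forall_compl_eq_zero fun ζ hζ => by
      rw [image_eq_zero_of_notMem_tsupport hζ, zero_mul]).symm
  simp only [this]
  have : ProperSpace V := FiniteDimensional.proper ℝ V
  refine continuous_parametric_integral_of_continuous ?_ hψc.isCompact
  fun_prop

/-- Plancherel's theorem for the surface kernel. -/
theorem integral_norm_surfaceKernel_sq {γ : E → V} {ψ : E → ℂ} (hγ : ContDiff ℝ ∞ γ)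
    (hψ : ContDiff ℝ ∞ ψ) (hψc : HasCompactSupport ψ) (x : V) :
    Integrable (fun z => ‖surfaceKernel γ ψ x z‖ ^ 2) ∧
    ∫ z, ‖surfaceKernel γ ψ x z‖ ^ 2 = ∫ ζ, ‖ψ ζ‖ ^ 2 := by
  -- For fixed `x` the kernel is the Fourier transform in `ζ` of `ψ` times a unimodular factor, so
  -- Plancherel sees only `|ψ|`.
  let F : E → ℂ := fun ζ => ψ ζ * Complex.exp (Complex.I * (-(2 * Real.pi * ⟪x, γ ζ⟫_ℝ) : ℝ))
  have hF : ContDiff ℝ ∞ F := hψ.mul (ContDiff.cexp (contDiff_const.mul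
    (Complex.ofRealCLM.contDiff.comp
      (contDiff_const.mul (contDiff_const.inner ℝ hγ)).neg)))
  let g : 𝓢(E, ℂ) := (hψc.mul_right (f' := fun ζ =>
    Complex.exp (Complex.I * (-(2 * Real.pi * ⟪x, γ ζ⟫_ℝ) : ℝ)))).toSchwartzMap hF
  have hg : ∀ ζ, g ζ = F ζ := fun ζ => rfl
  have hker : ∀ z, (𝓕 g) z = surfaceKernel γ ψ x z := fun z => by
    rw [SchwartzMap.fourier_coe, Real.fourier_eq']
    refine integral_congr_ae (Filter.Eventually.of_forall fun ζ => ?_)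
    simp only [hg, F, smul_eq_mul]
    rw [mul_left_comm, ← Complex.exp_add, real_inner_comm ζ z]
    congr 2
    push_cast
    ring
  have h1 := SchwartzMap.integral_norm_sq_fourier g
  have h2 : ∀ ζ, ‖g ζ‖ = ‖ψ ζ‖ := fun ζ => by
    rw [hg, norm_mul, mul_comm Complex.I, Complex.norm_exp_ofReal_mul_I, mul_one]
  simp only [hker, h2] at h1
  refine ⟨?_, h1⟩
  have := (memLp_two_iff_integrable_sq_norm (𝓕 g).continuous.aestronglyMeasurable).1
    ((𝓕 g).memLp 2 volume)
  simpa only [hker] using this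

end SurfaceMeasure

/-! ### Uniform bounds for the weighted kernel -/

section KernelBounds

open Module

variable {V E : Type*} [NormedAddCommGroup V] [InnerProductSpace ℝ V] [FiniteDimensional ℝ V]
  [NormedAddCommGroup E] [InnerProductSpace ℝ E] [FiniteDimensional ℝ E] [MeasurableSpace E]
  [BorelSpace E]

/-- Pointwise bound for the weighted surface kernel. -/
theorem exists_norm_mul_surfaceKernel_le {m : ℕ} (hm : finrank ℝ E = 2 * m) {γ : E → V}
    {ψ : E → ℂ} (hγ : ContDiff ℝ ∞ γ) (hψ : ContDiff ℝ ∞ ψ) (hψc : HasCompactSupport ψ)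
    (hnd : ∀ ζ ∈ tsupport ψ, HasNondegenerateNormals γ ζ) {c : V → ℂ} {A : ℝ}
    (hc : ∀ x, ‖c x‖ ≤ A * ‖x‖ ^ m) :
    ∃ C : ℝ, ∀ x z, ‖c x * surfaceKernel γ ψ x z‖ ≤ C * (1 + ‖z‖ ^ 2) ^ m := by
  obtain ⟨δ, hδ, B, hB⟩ := exists_pow_mul_norm_surfaceKernel_sq_le hγ hψ hψc hnd
  have hM : 0 ≤ ∫ ζ, ‖ψ ζ‖ := integral_nonneg fun _ => norm_nonneg _
  refine ⟨|A| * max (√B) (δ⁻¹ ^ m * ∫ ζ, ‖ψ ζ‖), fun x z => ?_⟩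
  have hw : 1 ≤ (1 + ‖z‖ ^ 2) ^ m := one_le_pow₀ (by nlinarith [sq_nonneg ‖z‖])
  have h1 : ‖x‖ ^ m * ‖surfaceKernel γ ψ x z‖ ≤
      max (√B) (δ⁻¹ ^ m * ∫ ζ, ‖ψ ζ‖) * (1 + ‖z‖ ^ 2) ^ m := by
    rcases le_or_gt ‖z‖ (δ * ‖x‖) with h | h
    · have h2 : ‖x‖ ^ m * ‖surfaceKernel γ ψ x z‖ ≤ √B := by
        refine Real.le_sqrt_of_sq_le ?_
        have := hB x z h
        rwa [hm, mul_comm 2 m, pow_mul, ← mul_pow] at this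
      exact (h2.trans (le_max_left _ _)).trans
        (le_mul_of_one_le_right (le_max_of_le_left (Real.sqrt_nonneg _)) hw)
    · have hx : ‖x‖ ≤ δ⁻¹ * (1 + ‖z‖ ^ 2) := by
        rw [inv_mul_eq_div, le_div_iff₀ hδ]
        nlinarith [sq_nonneg (‖z‖ - 1)]
      calc ‖x‖ ^ m * ‖surfaceKernel γ ψ x z‖
          ≤ (δ⁻¹ * (1 + ‖z‖ ^ 2)) ^ m * ∫ ζ, ‖ψ ζ‖ := by
            gcongr; exact norm_surfaceKernel_le γ ψ x z
        _ = (δ⁻¹ ^ m * ∫ ζ, ‖ψ ζ‖) * (1 + ‖z‖ ^ 2) ^ m := by rw [mul_pow]; ring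
        _ ≤ _ := by gcongr; exact le_max_right _ _
  calc ‖c x * surfaceKernel γ ψ x z‖ ≤ |A| * (‖x‖ ^ m * ‖surfaceKernel γ ψ x z‖) := by
        rw [norm_mul, ← mul_assoc]
        gcongr
        exact (hc x).trans (by gcongr; exact le_abs_self A)
    _ ≤ _ := by rw [mul_assoc]; gcongr

/-- Mean square bound for the weighted surface kernel on dyadic balls. -/
theorem exists_lintegral_ball_mul_surfaceKernel_le {m : ℕ} (hm : finrank ℝ E = 2 * m)
    {γ : E → V} {ψ : E → ℂ} (hγ : ContDiff ℝ ∞ γ) (hψ : ContDiff ℝ ∞ ψ)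
    (hψc : HasCompactSupport ψ) (hnd : ∀ ζ ∈ tsupport ψ, HasNondegenerateNormals γ ζ)
    {c : V → ℂ} {A : ℝ} (hc : ∀ x, ‖c x‖ ≤ A * ‖x‖ ^ m) :
    ∃ C : ℝ≥0, ∀ (x : V) (j : ℕ),
      ∫⁻ z in Metric.ball (0 : E) (2 ^ j), ‖c x * surfaceKernel γ ψ x z‖ₑ ^ 2 ≤
        C * ((2 : ℝ≥0∞) ^ (m * j)) ^ 2 := by
  obtain ⟨δ, hδ, B, hB⟩ := exists_pow_mul_norm_surfaceKernel_sq_le hγ hψ hψc hnd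
  set β : ℝ≥0 := (volume (Metric.ball (0 : E) 1)).toNNReal with hβ
  have hβ' : volume (Metric.ball (0 : E) 1) = β :=
    (ENNReal.coe_toNNReal measure_ball_lt_top.ne).symm
  set Q : ℝ := ∫ ζ, ‖ψ ζ‖ ^ 2 with hQ
  refine ⟨(A ^ 2).toNNReal * (B.toNNReal * β + (δ⁻¹ ^ (2 * m) * Q).toNNReal), fun x j => ?_⟩
  have hpt : ∀ z, ‖c x * surfaceKernel γ ψ x z‖ₑ ^ 2 ≤
      ENNReal.ofReal (A ^ 2) * ENNReal.ofReal (‖x‖ ^ (2 * m) * ‖surfaceKernel γ ψ x z‖ ^ 2) :=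
    fun z => by
      rw [← ENNReal.ofReal_mul (by positivity), ← ofReal_norm, ← ENNReal.ofReal_pow (norm_nonneg _)]
      refine ENNReal.ofReal_le_ofReal ?_
      rw [norm_mul, mul_pow]
      calc ‖c x‖ ^ 2 * ‖surfaceKernel γ ψ x z‖ ^ 2
          ≤ (A * ‖x‖ ^ m) ^ 2 * ‖surfaceKernel γ ψ x z‖ ^ 2 := by gcongr; exact hc x
        _ = _ := by ring
  have hpow : ((2 : ℝ≥0∞) ^ (m * j)) ^ 2 = ENNReal.ofReal ((2 ^ j) ^ (2 * m)) := by
    rw [ENNReal.ofReal_pow (by positivity), ENNReal.ofReal_pow (by positivity),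
      ENNReal.ofReal_ofNat, ← pow_mul, ← pow_mul]
    congr 1; ring
  have hmain : ∫⁻ z in Metric.ball (0 : E) (2 ^ j),
      ENNReal.ofReal (‖x‖ ^ (2 * m) * ‖surfaceKernel γ ψ x z‖ ^ 2) ≤
      (ENNReal.ofReal B * β + ENNReal.ofReal (δ⁻¹ ^ (2 * m) * Q)) *
        ENNReal.ofReal ((2 ^ j) ^ (2 * m)) := by
    rw [add_mul]
    -- On a ball small compared with `‖x‖`, pointwise decay times volume suffices. On a larger ball,
    -- `‖x‖` is at most a multiple of `2 ^ j` and Plancherel over the whole space suffices. Both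
    -- give the power `2 * m` because this is the dimension of `E`.
    rcases le_or_gt (2 ^ j) (δ * ‖x‖) with h | h
    · refine le_add_right ?_
      calc ∫⁻ z in Metric.ball (0 : E) (2 ^ j),
            ENNReal.ofReal (‖x‖ ^ (2 * m) * ‖surfaceKernel γ ψ x z‖ ^ 2)
          ≤ ∫⁻ z in Metric.ball (0 : E) (2 ^ j), ENNReal.ofReal B := by
            refine setLIntegral_mono measurable_const fun z hz => ENNReal.ofReal_le_ofReal ?_
            rw [← hm]
            exact hB x z ((mem_ball_zero_iff.1 hz).le.trans h)
        _ = _ := by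
            rw [setLIntegral_const, Measure.addHaar_ball_of_pos _ _ (by positivity), hβ', hm]
            ring
    · refine le_add_left ?_
      have hx : ‖x‖ ≤ δ⁻¹ * 2 ^ j := by
        rw [inv_mul_eq_div, le_div_iff₀ hδ]; linarith
      obtain ⟨hint, hpl⟩ := integral_norm_surfaceKernel_sq hγ hψ hψc x
      calc ∫⁻ z in Metric.ball (0 : E) (2 ^ j),
            ENNReal.ofReal (‖x‖ ^ (2 * m) * ‖surfaceKernel γ ψ x z‖ ^ 2)
          ≤ ∫⁻ z, ENNReal.ofReal (‖x‖ ^ (2 * m) * ‖surfaceKernel γ ψ x z‖ ^ 2) :=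
            setLIntegral_le_lintegral _ _
        _ = ENNReal.ofReal (‖x‖ ^ (2 * m) * Q) := by
            rw [← ofReal_integral_eq_lintegral_ofReal (hint.const_mul _)
              (Filter.Eventually.of_forall fun _ => by positivity), integral_const_mul, hpl]
        _ ≤ ENNReal.ofReal ((δ⁻¹ * 2 ^ j) ^ (2 * m) * Q) := by
            refine ENNReal.ofReal_le_ofReal ?_
            have : 0 ≤ Q := integral_nonneg fun _ => by positivity
            gcongr
        _ = _ := by
            rw [← ENNReal.ofReal_mul' (by positivity)]
            congr 1; rw [mul_pow]; ring
  calc ∫⁻ z in Metric.ball (0 : E) (2 ^ j), ‖c x * surfaceKernel γ ψ x z‖ₑ ^ 2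
      ≤ ∫⁻ z in Metric.ball (0 : E) (2 ^ j), ENNReal.ofReal (A ^ 2) *
        ENNReal.ofReal (‖x‖ ^ (2 * m) * ‖surfaceKernel γ ψ x z‖ ^ 2) := lintegral_mono hpt
    _ = ENNReal.ofReal (A ^ 2) * ∫⁻ z in Metric.ball (0 : E) (2 ^ j),
        ENNReal.ofReal (‖x‖ ^ (2 * m) * ‖surfaceKernel γ ψ x z‖ ^ 2) :=
        lintegral_const_mul' _ _ ENNReal.ofReal_ne_top
    _ ≤ ENNReal.ofReal (A ^ 2) * ((ENNReal.ofReal B * β + ENNReal.ofReal (δ⁻¹ ^ (2 * m) * Q)) *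
        ENNReal.ofReal ((2 ^ j) ^ (2 * m))) := by gcongr
    _ = _ := by
        rw [hpow]
        simp only [ENNReal.coe_mul, ENNReal.coe_add, ENNReal.ofReal]
        ring

end KernelBounds

/-! ### Integral operators from `L¹` to tempered distributions -/

section KernelTransform

set_option linter.unusedSectionVars false

open Module

variable {V E : Type*} [NormedAddCommGroup V] [InnerProductSpace ℝ V] [FiniteDimensional ℝ V]
  [MeasurableSpace V] [BorelSpace V]
  [NormedAddCommGroup E] [InnerProductSpace ℝ E] [FiniteDimensional ℝ E] [MeasurableSpace E]
  [BorelSpace E]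

/-- The integral operator with kernel `k`. -/
noncomputable def kernelTransform (k : V → E → ℂ) (f : V → ℂ) (z : E) : ℂ := ∫ x, f x * k x z

theorem kernelTransform_congr {k : V → E → ℂ} {f g : V → ℂ} (h : f =ᵐ[volume] g) (z : E) :
    kernelTransform k f z = kernelTransform k g z :=
  integral_congr_ae (h.mono fun x hx => by simp only [hx])

theorem integrable_mul_kernel {k : V → E → ℂ} (hk : Continuous (Function.uncurry k)) {z : E}
    {B : ℝ} (hB : ∀ x, ‖k x z‖ ≤ B) {f : V → ℂ} (hf : Integrable f) :
    Integrable fun x => f x * k x z :=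
  hf.mul_bdd (c := B) (hk.comp (by fun_prop : Continuous fun x : V => (x, z))).aestronglyMeasurable
    (Filter.Eventually.of_forall hB)

theorem norm_kernelTransform_le {k : V → E → ℂ} {z : E} {B : ℝ} (hB : ∀ x, ‖k x z‖ ≤ B)
    {f : V → ℂ} (hf : Integrable f) : ‖kernelTransform k f z‖ ≤ B * ∫ x, ‖f x‖ := by
  rw [← integral_const_mul]
  refine norm_integral_le_of_norm_le (hf.norm.const_mul B)
    (Filter.Eventually.of_forall fun x => ?_)
  rw [norm_mul, mul_comm]
  exact mul_le_mul_of_nonneg_right (hB x) (norm_nonneg _)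

theorem aestronglyMeasurable_kernelTransform {k : V → E → ℂ}
    (hk : Continuous (Function.uncurry k)) {f : V → ℂ} (hf : AEStronglyMeasurable f) (μ : Measure E)
    [SFinite μ] : AEStronglyMeasurable (kernelTransform k f) μ := by
  refine AEStronglyMeasurable.integral_prod_right' (f := fun q : E × V => f q.2 * k q.2 q.1) ?_
  exact hf.comp_snd.mul (hk.comp continuous_swap).aestronglyMeasurable

/-- Minkowski's integral inequality in `L²` for an integral operator. -/
theorem lintegral_enorm_kernelTransform_sq_le {k : V → E → ℂ}
    (hk : Continuous (Function.uncurry k)) {μ : Measure E} [SFinite μ] {B : ℝ≥0∞}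
    (hB : ∀ x, ∫⁻ z, ‖k x z‖ₑ ^ 2 ∂μ ≤ B) {f : V → ℂ} (hf : AEStronglyMeasurable f) :
    ∫⁻ z, ‖kernelTransform k f z‖ₑ ^ 2 ∂μ ≤ B * (∫⁻ x, ‖f x‖ₑ) ^ 2 := by
  have hkx : ∀ z, AEMeasurable (fun x => ‖k x z‖ₑ) := fun z =>
    (hk.comp (by fun_prop : Continuous fun x : V => (x, z))).enorm.measurable.aemeasurable
  have hcs : ∀ z, ‖kernelTransform k f z‖ₑ ^ 2 ≤
      (∫⁻ x, ‖f x‖ₑ) * ∫⁻ x, ‖f x‖ₑ * ‖k x z‖ₑ ^ 2 := fun z => by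
    -- Splitting `‖f‖` into two square roots makes Hölder's inequality the Cauchy–Schwarz inequality
    -- for the measure `‖f x‖ dx`.
    have h1 : ‖kernelTransform k f z‖ₑ ≤ ∫⁻ x, ‖f x‖ₑ ^ (1 / 2 : ℝ) *
        (‖f x‖ₑ ^ (1 / 2 : ℝ) * ‖k x z‖ₑ) := by
      refine (enorm_integral_le_lintegral_enorm _).trans (le_of_eq ?_)
      refine lintegral_congr fun x => ?_
      rw [enorm_mul, ← mul_assoc, ← ENNReal.rpow_add_of_nonneg _ _ (by norm_num) (by norm_num)]
      norm_num
    have h2 := ENNReal.lintegral_mul_le_Lp_mul_Lq volume Real.HolderConjugate.two_two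
      (hf.enorm.pow_const (1 / 2 : ℝ)) ((hf.enorm.pow_const (1 / 2 : ℝ)).mul (hkx z))
    have h3 : ∀ a : ℝ≥0∞, (a ^ (1 / 2 : ℝ)) ^ 2 = a := fun a => by
      rw [← ENNReal.rpow_natCast, ← ENNReal.rpow_mul]; norm_num
    calc ‖kernelTransform k f z‖ₑ ^ 2 ≤ _ := pow_le_pow_left₀ zero_le (h1.trans h2) 2
      _ = _ := by
        simp only [mul_pow, ENNReal.rpow_two, Pi.mul_apply, h3]
  calc ∫⁻ z, ‖kernelTransform k f z‖ₑ ^ 2 ∂μ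
      ≤ ∫⁻ z, (∫⁻ x, ‖f x‖ₑ) * (∫⁻ x, ‖f x‖ₑ * ‖k x z‖ₑ ^ 2) ∂μ := lintegral_mono hcs
    _ = (∫⁻ x, ‖f x‖ₑ) * ∫⁻ x, ∫⁻ z, ‖f x‖ₑ * ‖k x z‖ₑ ^ 2 ∂μ ∂volume := by
        have hmeas : AEMeasurable (Function.uncurry fun (z : E) (x : V) =>
            ‖f x‖ₑ * ‖k x z‖ₑ ^ 2) (μ.prod volume) :=
          hf.comp_snd.enorm.mul
            ((hk.comp continuous_swap).enorm.measurable.aemeasurable.pow_const 2)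
        have hmeas' : AEMeasurable (fun z => ∫⁻ x, ‖f x‖ₑ * ‖k x z‖ₑ ^ 2) μ :=
          hmeas.lintegral_prod_right'
        rw [lintegral_const_mul'' _ hmeas', lintegral_lintegral_swap hmeas]
    _ ≤ (∫⁻ x, ‖f x‖ₑ) * ∫⁻ x, ‖f x‖ₑ * B := by
        gcongr with x
        have hkz : Measurable fun z => ‖k x z‖ₑ :=
          (hk.comp (by fun_prop : Continuous fun z : E => (x, z))).enorm.measurable
        rw [lintegral_const_mul _ (hkz.pow_const 2)]
        gcongr
        exact hB x
    _ = _ := by rw [lintegral_mul_const'' _ hf.enorm]; ring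

variable (E) in
/-- The polynomial weight `(1 + ‖z‖ ^ 2) ^ m`. -/
noncomputable def polyWeight (m : ℕ) (z : E) : ℂ := (((1 + ‖z‖ ^ 2) ^ m : ℝ) : ℂ)

theorem hasTemperateGrowth_polyWeight (m : ℕ) :
    (polyWeight E m).HasTemperateGrowth := by
  have h1 : (fun z : E => (1 + ‖z‖ ^ 2) ^ m).HasTemperateGrowth :=
    ((Function.HasTemperateGrowth.const (1 : ℝ)).add
      (Function.hasTemperateGrowth_norm_sq (H := E))).pow m
  exact Function.Complex.hasTemperateGrowth_ofReal.comp h1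

theorem norm_polyWeight (m : ℕ) (z : E) : ‖polyWeight E m z‖ = (1 + ‖z‖ ^ 2) ^ m := by
  rw [polyWeight, Complex.norm_real, Real.norm_eq_abs, abs_of_nonneg (by positivity)]

theorem polyWeight_ne_zero (m : ℕ) (z : E) : polyWeight E m z ≠ 0 := by
  rw [← norm_ne_zero_iff, norm_polyWeight]; positivity

/-- Dividing by the weight places the transform in `L^∞`, which embeds continuously in the tempered
distributions. Multiplying the weight back is continuous there, so the extension is continuous on
`L¹`. -/
theorem norm_inv_polyWeight_mul_kernelTransform_le {m : ℕ} {k : V → E → ℂ} {C : ℝ}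
    (hC : ∀ x z, ‖k x z‖ ≤ C * (1 + ‖z‖ ^ 2) ^ m)
    (f : Lp ℂ 1 (volume : Measure V)) (z : E) :
    ‖(polyWeight E m z)⁻¹ * kernelTransform k f z‖ ≤ C * ‖f‖ := by
  rw [norm_mul, norm_inv, norm_polyWeight, inv_mul_le_iff₀ (by positivity),
    L1.norm_eq_integral_norm]
  refine (norm_kernelTransform_le (fun x => hC x z) (L1.integrable_coeFn f)).trans (le_of_eq ?_)
  ring

theorem memLp_inv_polyWeight_mul_kernelTransform {m : ℕ} {k : V → E → ℂ} {C : ℝ}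
    (hk : Continuous (Function.uncurry k)) (hC : ∀ x z, ‖k x z‖ ≤ C * (1 + ‖z‖ ^ 2) ^ m)
    (f : Lp ℂ 1 (volume : Measure V)) :
    MemLp (fun z => (polyWeight E m z)⁻¹ * kernelTransform k f z) ∞ volume :=
  memLp_top_of_bound (AEStronglyMeasurable.mul
      ((hasTemperateGrowth_polyWeight m).1.continuous.inv₀
        (polyWeight_ne_zero m)).aestronglyMeasurable
      (aestronglyMeasurable_kernelTransform hk (L1.integrable_coeFn f).1 volume)) _
    (Filter.Eventually.of_forall (norm_inv_polyWeight_mul_kernelTransform_le hC f))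

/-- An integral operator whose kernel grows at most polynomially in the second variable, as a map
from `L¹` to a weighted `L^∞` space. -/
noncomputable def weightedKernelCLM {m : ℕ} {k : V → E → ℂ} {C : ℝ}
    (hk : Continuous (Function.uncurry k)) (hC : ∀ x z, ‖k x z‖ ≤ C * (1 + ‖z‖ ^ 2) ^ m) :
    Lp ℂ 1 (volume : Measure V) →L[ℂ] Lp ℂ ∞ (volume : Measure E) :=
  LinearMap.mkContinuous
    { toFun := fun f => (memLp_inv_polyWeight_mul_kernelTransform hk hC f).toLp _
      map_add' := fun f g => by
        rw [← MemLp.toLp_add]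
        congr 1
        funext z
        rw [Pi.add_apply, ← mul_add, kernelTransform_congr (Lp.coeFn_add f g)]
        congr 1
        rw [kernelTransform, kernelTransform, kernelTransform, ← integral_add
          (integrable_mul_kernel hk (fun x => hC x z) (L1.integrable_coeFn f))
          (integrable_mul_kernel hk (fun x => hC x z) (L1.integrable_coeFn g))]
        simp only [Pi.add_apply, add_mul]
      map_smul' := fun c f => by
        rw [RingHom.id_apply, ← MemLp.toLp_const_smul]
        congr 1
        funext z
        rw [Pi.smul_apply, smul_eq_mul, mul_left_comm, kernelTransform_congr (Lp.coeFn_smul c f)]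
        congr 1
        rw [kernelTransform, kernelTransform, ← integral_const_mul]
        simp only [Pi.smul_apply, smul_eq_mul, mul_assoc] } C fun f => by
    have h0 : 0 ≤ C * ‖f‖ :=
      (norm_nonneg _).trans (norm_inv_polyWeight_mul_kernelTransform_le hC f 0)
    refine (Lp.norm_toLp _ (memLp_inv_polyWeight_mul_kernelTransform hk hC f)).trans_le
      (ENNReal.toReal_le_of_le_ofReal h0 ?_)
    rw [eLpNorm_exponent_top]
    exact eLpNormEssSup_le_of_ae_bound
      (Filter.Eventually.of_forall (norm_inv_polyWeight_mul_kernelTransform_le hC f))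

theorem coeFn_weightedKernelCLM {m : ℕ} {k : V → E → ℂ} {C : ℝ}
    (hk : Continuous (Function.uncurry k)) (hC : ∀ x z, ‖k x z‖ ≤ C * (1 + ‖z‖ ^ 2) ^ m)
    (f : Lp ℂ 1 (volume : Measure V)) :
    weightedKernelCLM hk hC f =ᵐ[volume]
      fun z => (polyWeight E m z)⁻¹ * kernelTransform k f z :=
  MemLp.coeFn_toLp (memLp_inv_polyWeight_mul_kernelTransform hk hC f)

/-- The map sending `f ∈ L¹` to the tempered distribution whose Fourier transform is
`∫ f(x) k(x, ·) dx`. -/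
noncomputable def kernelDistributionCLM {m : ℕ} {k : V → E → ℂ} {C : ℝ}
    (hk : Continuous (Function.uncurry k)) (hC : ∀ x z, ‖k x z‖ ≤ C * (1 + ‖z‖ ^ 2) ^ m) :
    Lp ℂ 1 (volume : Measure V) →L[ℂ] 𝓢'(E, ℂ) :=
  (FourierTransform.fourierInvCLM ℂ 𝓢'(E, ℂ)) ∘L
    (TemperedDistribution.smulLeftCLM ℂ (polyWeight E m)) ∘L
    (Lp.toTemperedDistributionCLM ℂ volume ∞) ∘L weightedKernelCLM hk hC

theorem kernelDistributionCLM_apply {m : ℕ} {k : V → E → ℂ} {C : ℝ}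
    (hk : Continuous (Function.uncurry k)) (hC : ∀ x z, ‖k x z‖ ≤ C * (1 + ‖z‖ ^ 2) ^ m)
    (f : Lp ℂ 1 (volume : Measure V)) (η : 𝓢(E, ℂ)) :
    kernelDistributionCLM hk hC f η = ∫ z, (𝓕⁻ η) z * kernelTransform k f z := by
  have h1 : kernelDistributionCLM hk hC f η =
      ∫ z, (SchwartzMap.smulLeftCLM ℂ (polyWeight E m) (𝓕⁻ η)) z • weightedKernelCLM hk hC f z := by
    rw [← Lp.toTemperedDistribution_apply]
    rfl
  rw [h1]
  refine integral_congr_ae ((coeFn_weightedKernelCLM hk hC f).mono fun z hz => ?_)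
  simp only [hz]
  rw [SchwartzMap.smulLeftCLM_apply_apply (hasTemperateGrowth_polyWeight m)]
  have := polyWeight_ne_zero m z
  simp only [smul_eq_mul]
  field_simp

theorem integrable_schwartz_mul_kernelTransform {m : ℕ} {k : V → E → ℂ} {C : ℝ}
    (hk : Continuous (Function.uncurry k)) (hC : ∀ x z, ‖k x z‖ ≤ C * (1 + ‖z‖ ^ 2) ^ m)
    (f : Lp ℂ 1 (volume : Measure V)) (η : 𝓢(E, ℂ)) :
    Integrable fun z => η z * kernelTransform k f z := by
  have h1 := (SchwartzMap.smulLeftCLM ℂ (polyWeight E m) η).integrable (μ := volume)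
  have h2 := h1.mul_bdd (c := C * ‖f‖) (memLp_inv_polyWeight_mul_kernelTransform hk hC f).1
    (Filter.Eventually.of_forall (norm_inv_polyWeight_mul_kernelTransform_le hC f))
  refine h2.congr (Filter.Eventually.of_forall fun z => ?_)
  simp only
  rw [SchwartzMap.smulLeftCLM_apply_apply (hasTemperateGrowth_polyWeight m)]
  have := polyWeight_ne_zero m z
  simp only [smul_eq_mul]
  field_simp

theorem hasFourierDensity_kernelDistributionCLM {n m : ℕ} {k : V → Rn n → ℂ} {C : ℝ}
    (hk : Continuous (Function.uncurry k)) (hC : ∀ x z, ‖k x z‖ ≤ C * (1 + ‖z‖ ^ 2) ^ m)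
    (f : Lp ℂ 1 (volume : Measure V)) :
    HasFourierDensity (kernelDistributionCLM hk hC f) (kernelTransform k f) := fun η => by
  refine ⟨integrable_schwartz_mul_kernelTransform hk hC f η, ?_⟩
  rw [TemperedDistribution.fourier_apply, kernelDistributionCLM_apply]
  simp

end KernelTransform

/-! ### Besov and Sobolev bounds from dyadic kernel estimates -/

section NormBounds

set_option linter.unusedSectionVars false

theorem eLpNorm_two_le_of_lintegral_sq_le {X : Type*} [MeasurableSpace X] {μ : Measure X}
    {g : X → ℂ} {A : ℝ≥0∞} (h : ∫⁻ z, ‖g z‖ₑ ^ 2 ∂μ ≤ A ^ 2) : eLpNorm g 2 μ ≤ A := by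
  rw [eLpNorm_eq_lintegral_rpow_enorm_toReal (by norm_num) (by norm_num)]
  simp only [ENNReal.toReal_ofNat, ENNReal.rpow_two]
  calc (∫⁻ z, ‖g z‖ₑ ^ 2 ∂μ) ^ (1 / 2 : ℝ) ≤ (A ^ 2) ^ (1 / 2 : ℝ) := by gcongr
    _ = A := by rw [← ENNReal.rpow_natCast, ← ENNReal.rpow_mul]; norm_num

theorem L1.lintegral_enorm_coeFn {X : Type*} [MeasurableSpace X] {μ : Measure X}
    (f : Lp ℂ 1 μ) : ∫⁻ x, ‖f x‖ₑ ∂μ = ‖f‖ₑ := by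
  rw [Lp.enorm_def, eLpNorm_one_eq_lintegral_enorm]

theorem measurableSet_dyadicRegion (n j : ℕ) : MeasurableSet (dyadicRegion n j) := by
  cases j with
  | zero => exact measurableSet_ball
  | succ j => exact measurableSet_ball.diff measurableSet_ball

theorem dyadicRegion_subset_ball (n j : ℕ) :
    dyadicRegion n j ⊆ Metric.ball (0 : Rn n) (2 ^ j) := by
  cases j with
  | zero => simp [dyadicRegion]
  | succ j => exact Set.sdiff_subset

theorem two_pow_le_of_mem_dyadicRegion {n j : ℕ} {z : Rn n} (hz : z ∈ dyadicRegion n j) :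
    2 ^ j / 2 ≤ 1 + ‖z‖ := by
  cases j with
  | zero => have := norm_nonneg z; norm_num; linarith
  | succ j =>
    have h : ¬ ‖z‖ < 2 ^ j := fun h => hz.2 (mem_ball_zero_iff.2 h)
    rw [pow_succ]; linarith [not_lt.1 h]

theorem iUnion_dyadicRegion (n : ℕ) : ⋃ j, dyadicRegion n j = Set.univ := by
  refine Set.eq_univ_of_forall fun z => ?_
  have hex : ∃ j : ℕ, ‖z‖ < 2 ^ j := pow_unbounded_of_one_lt ‖z‖ one_lt_two
  classical
  refine Set.mem_iUnion.2 ⟨Nat.find hex, ?_⟩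
  have h1 := Nat.find_spec hex
  cases hj : Nat.find hex with
  | zero => rw [hj] at h1; simpa [dyadicRegion] using h1
  | succ j =>
    rw [hj] at h1
    have h2 : ¬ ‖z‖ < 2 ^ j := Nat.find_min hex (by omega)
    exact ⟨mem_ball_zero_iff.2 h1, fun h => h2 (mem_ball_zero_iff.1 h)⟩

variable {V : Type*} [NormedAddCommGroup V] [InnerProductSpace ℝ V] [FiniteDimensional ℝ V]
  [MeasurableSpace V] [BorelSpace V]

/-- Each dyadic region lies in the ball of radius `2 ^ j`, where Minkowski gives growth `2 ^ (m *
j)`. The Besov weight cancels exactly this growth. -/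
theorem besovNorm_kernelDistributionCLM_le {n m : ℕ} {k : V → Rn n → ℂ} {C : ℝ}
    (hk : Continuous (Function.uncurry k)) (hC : ∀ x z, ‖k x z‖ ≤ C * (1 + ‖z‖ ^ 2) ^ m)
    {B : ℝ≥0} (hB : ∀ (x : V) (j : ℕ), ∫⁻ z in Metric.ball (0 : Rn n) (2 ^ j), ‖k x z‖ₑ ^ 2 ≤
      B * ((2 : ℝ≥0∞) ^ (m * j)) ^ 2) (f : Lp ℂ 1 (volume : Measure V)) :
    besovNorm (-(m : ℝ)) (kernelDistributionCLM hk hC f) ≤ NNReal.sqrt B * ‖f‖ₑ := by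
  refine iInf₂_le_of_le _ (hasFourierDensity_kernelDistributionCLM hk hC f)
    (iSup_le fun j => ?_)
  rw [eLpNorm_indicator_eq_eLpNorm_restrict (measurableSet_dyadicRegion n j)]
  have hsq : (B : ℝ≥0∞) = (NNReal.sqrt B : ℝ≥0∞) ^ 2 := by
    rw [← ENNReal.coe_pow, NNReal.sq_sqrt]
  have h1 : eLpNorm (kernelTransform k f) 2 (volume.restrict (dyadicRegion n j)) ≤
      NNReal.sqrt B * 2 ^ (m * j) * ‖f‖ₑ := by
    refine eLpNorm_two_le_of_lintegral_sq_le ?_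
    refine (lintegral_enorm_kernelTransform_sq_le hk (fun x =>
      (lintegral_mono_set (dyadicRegion_subset_ball n j)).trans (hB x j))
      (L1.integrable_coeFn f).1).trans (le_of_eq ?_)
    rw [L1.lintegral_enorm_coeFn, hsq]
    ring
  have h2 : (2 : ℝ≥0∞) ^ (-(m : ℝ) * j) * 2 ^ (m * j) = 1 := by
    rw [← ENNReal.rpow_natCast 2 (m * j), ← ENNReal.rpow_add _ _ (by norm_num) (by norm_num)]
    push_cast
    simp
  calc (2 : ℝ≥0∞) ^ (-(m : ℝ) * j) * eLpNorm (kernelTransform k f) 2 _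
      ≤ (2 : ℝ≥0∞) ^ (-(m : ℝ) * j) * (NNReal.sqrt B * 2 ^ (m * j) * ‖f‖ₑ) := by gcongr
    _ = ((2 : ℝ≥0∞) ^ (-(m : ℝ) * j) * 2 ^ (m * j)) * (NNReal.sqrt B * ‖f‖ₑ) := by ring
    _ = _ := by rw [h2, one_mul]

/-- On the `j`-th region the squared weight is of order `2 ^ (-2sj)` against a mean square of order
`2 ^ (2mj)`; the sum over `j` converges exactly because `s > m`. -/
theorem exists_lintegral_weight_mul_kernel_le {n m : ℕ} {k : V → Rn n → ℂ}
    (hk : Continuous (Function.uncurry k)) {B : ℝ≥0}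
    (hB : ∀ (x : V) (j : ℕ), ∫⁻ z in Metric.ball (0 : Rn n) (2 ^ j), ‖k x z‖ₑ ^ 2 ≤
      B * ((2 : ℝ≥0∞) ^ (m * j)) ^ 2) {s : ℝ} (hs : (m : ℝ) < s) :
    ∃ D : ℝ≥0, ∀ x, ∫⁻ z, ‖(((1 + ‖z‖) ^ (-s) : ℝ) : ℂ) * k x z‖ₑ ^ 2 ≤ D := by
  set q : ℝ≥0∞ := (2 : ℝ≥0∞) ^ ((m : ℝ) - s) with hq
  have hq1 : q ^ 2 < 1 :=
    pow_lt_one₀ zero_le (ENNReal.rpow_lt_one_of_one_lt_of_neg (by norm_num) (by linarith))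
      (by norm_num)
  -- The sum of a geometric series of ratio `q ^ 2`. The factor `2 ^ s` pays for the halving in `2 ^
  -- j / 2 ≤ 1 + ‖z‖`.
  set M : ℝ≥0∞ := ((2 : ℝ≥0∞) ^ s) ^ 2 * B * (1 - q ^ 2)⁻¹ with hM
  have h2s : (2 : ℝ≥0∞) ^ s ≠ ⊤ := ENNReal.rpow_ne_top_of_ne_zero (by norm_num) (by norm_num)
  have hMtop : M ≠ ⊤ := ENNReal.mul_ne_top (ENNReal.mul_ne_top (ENNReal.pow_ne_top h2s)
    ENNReal.coe_ne_top)
    (ENNReal.inv_ne_top.2 (tsub_pos_of_lt hq1).ne')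
  refine ⟨M.toNNReal, fun x => ?_⟩
  rw [ENNReal.coe_toNNReal hMtop]
  have hpt : ∀ j, ∀ z ∈ dyadicRegion n j, ‖(((1 + ‖z‖) ^ (-s) : ℝ) : ℂ) * k x z‖ₑ ^ 2 ≤
      ((2 : ℝ≥0∞) ^ s * (2 : ℝ≥0∞) ^ (-s * j)) ^ 2 * ‖k x z‖ₑ ^ 2 := fun j z hz => by
    rw [enorm_mul, mul_pow]
    gcongr
    have h1 : (1 + ‖z‖) ^ (-s) ≤ 2 ^ s * 2 ^ (-s * j) := by
      calc (1 + ‖z‖) ^ (-s) ≤ (2 ^ j / 2) ^ (-s) :=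
            Real.rpow_le_rpow_of_nonpos (by positivity) (two_pow_le_of_mem_dyadicRegion hz)
              (by have : (0 : ℝ) ≤ m := Nat.cast_nonneg m
                  linarith)
        _ = _ := by
            rw [Real.div_rpow (by positivity) (by positivity), Real.rpow_neg zero_le_two s,
              div_inv_eq_mul, mul_comm, ← Real.rpow_natCast, ← Real.rpow_mul zero_le_two]
            congr 2; ring
    rw [← ofReal_norm, Complex.norm_real, Real.norm_eq_abs, abs_of_nonneg (by positivity)]
    refine (ENNReal.ofReal_le_ofReal h1).trans (le_of_eq ?_)
    rw [ENNReal.ofReal_mul (by positivity), ← ENNReal.ofReal_rpow_of_pos two_pos,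
      ← ENNReal.ofReal_rpow_of_pos two_pos, ENNReal.ofReal_ofNat]
  have hkx : Measurable fun z => ‖k x z‖ₑ :=
    (hk.comp (by fun_prop : Continuous fun z => (x, z))).enorm.measurable
  have hj : ∀ j, ∫⁻ z in dyadicRegion n j, ‖(((1 + ‖z‖) ^ (-s) : ℝ) : ℂ) * k x z‖ₑ ^ 2 ≤
      ((2 : ℝ≥0∞) ^ s) ^ 2 * B * (q ^ 2) ^ j := fun j => by
    calc ∫⁻ z in dyadicRegion n j, ‖(((1 + ‖z‖) ^ (-s) : ℝ) : ℂ) * k x z‖ₑ ^ 2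
        ≤ ∫⁻ z in dyadicRegion n j,
          ((2 : ℝ≥0∞) ^ s * (2 : ℝ≥0∞) ^ (-s * j)) ^ 2 * ‖k x z‖ₑ ^ 2 :=
          setLIntegral_mono ((hkx.pow_const 2).const_mul _) (hpt j)
      _ = ((2 : ℝ≥0∞) ^ s * (2 : ℝ≥0∞) ^ (-s * j)) ^ 2 *
          ∫⁻ z in dyadicRegion n j, ‖k x z‖ₑ ^ 2 := lintegral_const_mul _ (hkx.pow_const 2)
      _ ≤ ((2 : ℝ≥0∞) ^ s * (2 : ℝ≥0∞) ^ (-s * j)) ^ 2 * (B * ((2 : ℝ≥0∞) ^ (m * j)) ^ 2) := by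
          gcongr
          exact (lintegral_mono_set (dyadicRegion_subset_ball n j)).trans (hB x j)
      _ = ((2 : ℝ≥0∞) ^ s) ^ 2 * B * ((2 : ℝ≥0∞) ^ (-s * j) * (2 : ℝ≥0∞) ^ (m * j)) ^ 2 := by ring
      _ = _ := by
          rw [← ENNReal.rpow_natCast 2 (m * j),
            ← ENNReal.rpow_add _ _ (by norm_num) (by norm_num), ← pow_mul, mul_comm 2 j, pow_mul,
            hq, ← ENNReal.rpow_natCast _ j, ← ENNReal.rpow_mul]
          congr 3
          push_cast; ring
  calc ∫⁻ z, ‖(((1 + ‖z‖) ^ (-s) : ℝ) : ℂ) * k x z‖ₑ ^ 2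
      = ∫⁻ z in ⋃ j, dyadicRegion n j, ‖(((1 + ‖z‖) ^ (-s) : ℝ) : ℂ) * k x z‖ₑ ^ 2 := by
        rw [iUnion_dyadicRegion, setLIntegral_univ]
    _ ≤ ∑' j, ∫⁻ z in dyadicRegion n j, ‖(((1 + ‖z‖) ^ (-s) : ℝ) : ℂ) * k x z‖ₑ ^ 2 :=
        lintegral_iUnion_le _ _
    _ ≤ ∑' j, ((2 : ℝ≥0∞) ^ s) ^ 2 * B * (q ^ 2) ^ j := ENNReal.tsum_le_tsum hj
    _ = M := by rw [ENNReal.tsum_mul_left, ENNReal.tsum_geometric]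

/-- The weight depends only on `z` and can be moved into the kernel, so Minkowski's inequality
applies once over the whole space. -/
theorem exists_sobolevNorm_kernelDistributionCLM_le {n m : ℕ} {k : V → Rn n → ℂ} {C : ℝ}
    (hk : Continuous (Function.uncurry k)) (hC : ∀ x z, ‖k x z‖ ≤ C * (1 + ‖z‖ ^ 2) ^ m)
    {B : ℝ≥0} (hB : ∀ (x : V) (j : ℕ), ∫⁻ z in Metric.ball (0 : Rn n) (2 ^ j), ‖k x z‖ₑ ^ 2 ≤
      B * ((2 : ℝ≥0∞) ^ (m * j)) ^ 2) {s : ℝ} (hs : (m : ℝ) < s) :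
    ∃ D : ℝ≥0, ∀ f, sobolevNorm (-s) (kernelDistributionCLM hk hC f) ≤ D * ‖f‖ₑ := by
  obtain ⟨D, hD⟩ := exists_lintegral_weight_mul_kernel_le hk hB hs
  refine ⟨NNReal.sqrt D, fun f => ?_⟩
  refine iInf₂_le_of_le _ (hasFourierDensity_kernelDistributionCLM hk hC f) ?_
  have hk' : Continuous (Function.uncurry fun (x : V) (z : Rn n) =>
      (((1 + ‖z‖) ^ (-s) : ℝ) : ℂ) * k x z) :=
    (Complex.continuous_ofReal.comp ((by fun_prop : Continuous fun q : V × Rn n =>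
      1 + ‖q.2‖).rpow_const fun q => Or.inl (by positivity))).mul hk
  have heq : ∀ z, (((1 + ‖z‖) ^ (-s) : ℝ) : ℂ) * kernelTransform k f z =
      kernelTransform (fun x z => (((1 + ‖z‖) ^ (-s) : ℝ) : ℂ) * k x z) f z := fun z => by
    rw [kernelTransform, kernelTransform, ← integral_const_mul]
    congr 1; funext x; ring
  simp only [heq]
  refine eLpNorm_two_le_of_lintegral_sq_le ?_
  refine (lintegral_enorm_kernelTransform_sq_le hk' hD (L1.integrable_coeFn f).1).trans
    (le_of_eq ?_)
  rw [L1.lintegral_enorm_coeFn, mul_pow, ← ENNReal.coe_pow, NNReal.sq_sqrt]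

end NormBounds

/-! ### Agreement with the classical trace on Schwartz functions -/

section SchwartzTraces

open Module
open scoped InnerProductSpace

/-- The symbol `(-2πi) ^ k x ^ α` of the derivative `∂_{α 1} ⋯ ∂_{α k}` of a Fourier transform. -/
noncomputable def gradSymbol {d k : ℕ} (α : Fin k → Fin d) (x : Rn d) : ℂ :=
  (-(2 * Real.pi * Complex.I)) ^ k * ∏ i, (x (α i) : ℂ)

theorem continuous_gradSymbol {d k : ℕ} (α : Fin k → Fin d) : Continuous (gradSymbol α) := by
  unfold gradSymbol
  fun_prop

theorem norm_gradSymbol_le {d k : ℕ} (α : Fin k → Fin d) (x : Rn d) :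
    ‖gradSymbol α x‖ ≤ (2 * Real.pi) ^ k * ‖x‖ ^ k := by
  rw [gradSymbol, norm_mul, norm_pow, norm_neg, norm_prod]
  have h1 : ‖(2 * Real.pi * Complex.I : ℂ)‖ = 2 * Real.pi := by
    simp [abs_of_pos Real.pi_pos]
  rw [h1]
  gcongr
  calc ∏ i, ‖(x (α i) : ℂ)‖ ≤ ∏ _i : Fin k, ‖x‖ := by
        refine Finset.prod_le_prod (fun i _ => norm_nonneg _) fun i _ => ?_
        rw [Complex.norm_real]
        exact PiLp.norm_apply_le x (α i)
    _ = ‖x‖ ^ k := by simp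

theorem integrable_gradSymbol_mul {d k : ℕ} (α : Fin k → Fin d) (f : 𝓢(Rn d, ℂ)) :
    Integrable fun x => gradSymbol α x * f x := by
  refine ((f.integrable_pow_mul volume k).const_mul ((2 * Real.pi) ^ k)).mono'
    ((continuous_gradSymbol α).mul f.continuous).aestronglyMeasurable
    (Filter.Eventually.of_forall fun x => ?_)
  rw [norm_mul, ← mul_assoc]
  gcongr
  exact norm_gradSymbol_le α x

theorem gradFourier_eq_integral {d k : ℕ} (f : 𝓢(Rn d, ℂ)) (α : Fin k → Fin d) (ξ : Rn d) :
    gradFourier f α ξ = ∫ x, Complex.exp (Complex.I * (-(2 * Real.pi * ⟪x, ξ⟫_ℝ) : ℝ)) *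
      (gradSymbol α x * f x) := by
  have hint : ∀ n : ℕ, (n : ℕ∞) ≤ ⊤ → Integrable fun x => ‖x‖ ^ n * ‖f x‖ := fun n _ =>
    f.integrable_pow_mul volume n
  rw [gradFourier, Real.iteratedFDeriv_fourier (N := ⊤) hint
    f.continuous.aestronglyMeasurable le_top]
  rw [Real.fourier_continuousMultilinearMap_apply (VectorFourier.integrable_fourierPowSMulRight
    (innerSL ℝ) (hint k le_top) f.continuous.aestronglyMeasurable), Real.fourier_eq']
  refine integral_congr_ae (Filter.Eventually.of_forall fun x => ?_)
  simp only [smul_eq_mul, VectorFourier.fourierPowSMulRight_apply, gradSymbol]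
  congr 1
  · congr 1; push_cast; ring
  · rw [Complex.real_smul, mul_assoc (_ ^ k)]
    congr 2
    rw [Complex.ofReal_prod]
    refine Finset.prod_congr rfl fun i _ => ?_
    rw [innerSL_apply_apply, EuclideanSpace.inner_single_right]
    simp

theorem contDiff_gradFourier {d k : ℕ} (f : 𝓢(Rn d, ℂ)) (α : Fin k → Fin d) :
    ContDiff ℝ ∞ (gradFourier f α) := by
  have h : ContDiff ℝ ∞ (𝓕 (f : Rn d → ℂ)) := by
    rw [← SchwartzMap.fourier_coe]
    exact (𝓕 f).smooth ⊤
  have h2 : ContDiff ℝ ∞ (iteratedFDeriv ℝ k (𝓕 (f : Rn d → ℂ))) :=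
    h.iteratedFDeriv_right (m := ∞) (by norm_cast)
  exact (ContinuousMultilinearMap.apply ℝ (fun _ : Fin k => Rn d) ℂ
    (fun i => EuclideanSpace.single (α i) 1)).contDiff.comp h2

variable {d k : ℕ} {E : Type*} [NormedAddCommGroup E] [InnerProductSpace ℝ E]
  [FiniteDimensional ℝ E] [MeasurableSpace E] [BorelSpace E]

/-- Fubini: integrating in `x` first produces the derivative of the Fourier transform on the
surface, and the remaining integral in `ζ` is a Fourier transform at `z`. -/
theorem kernelTransform_gradSymbol_eq_fourier (f : 𝓢(Rn d, ℂ)) (α : Fin k → Fin d)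
    {γ : E → Rn d} {ψ : E → ℂ} (hγ : Continuous γ) (hψ : Continuous ψ)
    (hψc : HasCompactSupport ψ) (z : E) :
    kernelTransform (fun x z => gradSymbol α x * surfaceKernel γ ψ x z) f z =
      𝓕 (fun ζ => ψ ζ * gradFourier f α (γ ζ)) z := by
  have hψi : Integrable ψ := hψ.integrable_of_hasCompactSupport hψc
  have hprod := (integrable_gradSymbol_mul α f).mul_prod hψi
  have hint : Integrable (Function.uncurry fun (x : Rn d) (ζ : E) => (gradSymbol α x * f x) *
      (ψ ζ * Complex.exp (Complex.I * (-(2 * Real.pi * (⟪x, γ ζ⟫_ℝ + ⟪z, ζ⟫_ℝ)) : ℝ))))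
      ((volume : Measure (Rn d)).prod (volume : Measure E)) := by
    refine hprod.mono ?_ (Filter.Eventually.of_forall fun q => ?_)
    · refine Continuous.aestronglyMeasurable ?_
      have := continuous_gradSymbol α
      have := f.continuous
      unfold Function.uncurry
      fun_prop
    · simp only [Function.uncurry]
      rw [norm_mul, norm_mul, norm_mul (ψ _), mul_comm Complex.I, Complex.norm_exp_ofReal_mul_I,
        mul_one, norm_mul, norm_mul]
  calc kernelTransform (fun x z => gradSymbol α x * surfaceKernel γ ψ x z) f z
      = ∫ x, ∫ ζ, (gradSymbol α x * f x) *
        (ψ ζ * Complex.exp (Complex.I * (-(2 * Real.pi * (⟪x, γ ζ⟫_ℝ + ⟪z, ζ⟫_ℝ)) : ℝ))) := by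
        rw [kernelTransform]
        congr 1; funext x
        rw [integral_const_mul, surfaceKernel]
        ring
    _ = ∫ ζ, ∫ x, (gradSymbol α x * f x) *
        (ψ ζ * Complex.exp (Complex.I * (-(2 * Real.pi * (⟪x, γ ζ⟫_ℝ + ⟪z, ζ⟫_ℝ)) : ℝ))) :=
        integral_integral_swap hint
    _ = 𝓕 (fun ζ => ψ ζ * gradFourier f α (γ ζ)) z := by
        rw [Real.fourier_eq']
        congr 1; funext ζ
        rw [gradFourier_eq_integral, smul_eq_mul, ← integral_const_mul, ← integral_const_mul]
        congr 1; funext x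
        rw [real_inner_comm ζ z]
        have : Complex.exp (Complex.I * (-(2 * Real.pi * (⟪x, γ ζ⟫_ℝ + ⟪ζ, z⟫_ℝ)) : ℝ)) =
            Complex.exp ((-2 * Real.pi * ⟪ζ, z⟫_ℝ : ℝ) * Complex.I) *
            Complex.exp (Complex.I * (-(2 * Real.pi * ⟪x, γ ζ⟫_ℝ) : ℝ)) := by
          rw [← Complex.exp_add]
          congr 1; push_cast; ring
        rw [this]; ring

/-- The density is the Fourier transform of the smooth compactly supported classical trace. Moving
that transform onto the test function cancels the inverse transform. -/
theorem isGivenBy_kernelDistributionCLM {n m : ℕ} {γ : Rn n → Rn d} {ψ : Rn n → ℂ}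
    (hγ : ContDiff ℝ ∞ γ) (hψ : ContDiff ℝ ∞ ψ) (hψc : HasCompactSupport ψ) (α : Fin k → Fin d)
    {C : ℝ} (hk : Continuous (Function.uncurry fun x z => gradSymbol α x * surfaceKernel γ ψ x z))
    (hC : ∀ x z, ‖gradSymbol α x * surfaceKernel γ ψ x z‖ ≤ C * (1 + ‖z‖ ^ 2) ^ m)
    (f : 𝓢(Rn d, ℂ)) :
    IsGivenBy (kernelDistributionCLM hk hC (f.toLp 1))
      (fun ζ => ψ ζ * gradFourier f α (γ ζ)) := fun η => by
  let u : 𝓢(Rn n, ℂ) := (hψc.mul_right (f' := fun ζ => gradFourier f α (γ ζ))).toSchwartzMap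
    (hψ.mul ((contDiff_gradFourier f α).comp hγ))
  have hu : ∀ ζ, u ζ = ψ ζ * gradFourier f α (γ ζ) := fun ζ => rfl
  have h1 : ∀ z, kernelTransform (fun x z => gradSymbol α x * surfaceKernel γ ψ x z)
      (f.toLp 1 (volume : Measure (Rn d))) z = (𝓕 u) z := fun z => by
    rw [kernelTransform_congr (f.coeFn_toLp 1 volume),
      kernelTransform_gradSymbol_eq_fourier f α hγ.continuous hψ.continuous hψc z,
      SchwartzMap.fourier_coe]
    rfl
  rw [kernelDistributionCLM_apply]
  simp only [h1, ← hu]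
  rw [← SchwartzMap.integral_fourier_mul_eq, FourierTransform.fourier_fourierInv_eq]

end SchwartzTraces

/-! ### Traces on graphs and hypersurfaces -/

section Traces

open Module Manifold
open scoped InnerProductSpace

/-- Multiply by a cutoff equal to `1` near `Z` and to `0` near the complement of `U`. Agreement near
each point of `Z`, not just at it, preserves the derivatives that enter nondegeneracy. -/
theorem exists_contDiff_eventuallyEq {E F : Type*} [NormedAddCommGroup E] [NormedSpace ℝ E]
    [FiniteDimensional ℝ E] [NormedAddCommGroup F] [NormedSpace ℝ F] {γ : E → F} {U Z : Set E}
    (hU : IsOpen U) (hγ : ContDiffOn ℝ ∞ γ U) (hZ : IsClosed Z) (hZU : Z ⊆ U) :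
    ∃ γ' : E → F, ContDiff ℝ ∞ γ' ∧ ∀ ζ ∈ Z, γ' =ᶠ[𝓝 ζ] γ := by
  obtain ⟨f, hf0, hf1, -⟩ := exists_contMDiffMap_zero_one_nhds_of_isClosed 𝓘(ℝ, E) (n := ⊤)
    hU.isClosed_compl hZ (Set.disjoint_compl_left_iff_subset.2 hZU)
  refine ⟨fun ζ => f ζ • γ ζ, contDiff_iff_contDiffAt.2 fun ζ => ?_, fun ζ hζ => ?_⟩
  · by_cases hζ : ζ ∈ U
    · exact f.contMDiff.contDiff.contDiffAt.smul (hγ.contDiffAt (hU.mem_nhds hζ))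
    · refine (contDiffAt_const (c := (0 : F))).congr_of_eventuallyEq ?_
      filter_upwards [hf0.filter_mono (nhds_le_nhdsSet hζ)] with x hx
      rw [hx, zero_smul]
  · filter_upwards [hf1.filter_mono (nhds_le_nhdsSet hζ)] with x hx
    rw [hx, one_smul]

/-- The trace of the derivative `∂^α f̂` of order `m` on a `2m`-dimensional immersed surface with
nondegenerate second fundamental form, as a map on `L¹`. -/
theorem exists_trace_gradFourier {m : ℕ} {U : Set (Rn (2 * m))}
    {γ : Rn (2 * m) → Rn (2 * m + 1)} {ψ : Rn (2 * m) → ℂ} (hU : IsOpen U)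
    (hγ : ContDiffOn ℝ ∞ γ U) (hψ : ContDiff ℝ ∞ ψ) (hψc : HasCompactSupport ψ)
    (hψU : tsupport ψ ⊆ U) (hnd : ∀ ζ ∈ U, HasNondegenerateNormals γ ζ)
    (α : Fin m → Fin (2 * m + 1)) :
    ∃ T : Lp ℂ 1 (volume : Measure (Rn (2 * m + 1))) →L[ℂ] 𝓢'(Rn (2 * m), ℂ),
      (∀ f : 𝓢(Rn (2 * m + 1), ℂ),
        IsGivenBy (T (f.toLp 1)) (fun ζ => ψ ζ * gradFourier f α (γ ζ))) ∧
      (∃ C : ℝ≥0, ∀ f, besovNorm (-(m : ℝ)) (T f) ≤ C * ‖f‖ₑ) ∧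
      ∀ s : ℝ, (m : ℝ) < s → ∃ C : ℝ≥0, ∀ f, sobolevNorm (-s) (T f) ≤ C * ‖f‖ₑ := by
  obtain ⟨γ', hγ', heq⟩ := exists_contDiff_eventuallyEq hU hγ (isClosed_tsupport ψ) hψU
  have hnd' : ∀ ζ ∈ tsupport ψ, HasNondegenerateNormals γ' ζ := fun ζ hζ =>
    (hnd ζ (hψU hζ)).congr (heq ζ hζ)
  have hdim : finrank ℝ (Rn (2 * m)) = 2 * m := finrank_euclideanSpace_fin
  obtain ⟨C, hC⟩ := exists_norm_mul_surfaceKernel_le hdim hγ' hψ hψc hnd' (norm_gradSymbol_le α)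
  obtain ⟨B, hB⟩ :=
    exists_lintegral_ball_mul_surfaceKernel_le hdim hγ' hψ hψc hnd' (norm_gradSymbol_le α)
  have hk : Continuous (Function.uncurry fun (x : Rn (2 * m + 1)) (z : Rn (2 * m)) =>
      gradSymbol α x * surfaceKernel γ' ψ x z) :=
    ((continuous_gradSymbol α).comp continuous_fst).mul
      (continuous_surfaceKernel hγ'.continuous hψ.continuous hψc)
  refine ⟨kernelDistributionCLM hk hC, fun f => ?_,
    ⟨NNReal.sqrt B, fun f => besovNorm_kernelDistributionCLM_le hk hC hB f⟩,
    fun s hs => exists_sobolevNorm_kernelDistributionCLM_le hk hC hB hs⟩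
  convert! isGivenBy_kernelDistributionCLM hγ' hψ hψc α hk hC f using 2 with ζ
  by_cases hζ : ζ ∈ tsupport ψ
  · rw [(heq ζ hζ).eq_of_nhds]
  · rw [image_eq_zero_of_notMem_tsupport hζ, zero_mul, zero_mul]

/-! ### Graphs -/

/-- The inclusion `ζ ↦ (ζ, 0)`. -/
noncomputable def graphInclusion (n : ℕ) : Rn n →L[ℝ] Rn (n + 1) :=
  ∑ i, (EuclideanSpace.proj i : Rn n →L[ℝ] ℝ).smulRight (EuclideanSpace.single i.castSucc 1)

theorem inner_graphInclusion {n : ℕ} (ν : Rn (n + 1)) (ζ : Rn n) :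
    ⟪ν, graphInclusion n ζ⟫_ℝ = ∑ i, ζ i * ν i.castSucc := by
  simp [graphInclusion, inner_sum, real_inner_smul_right, EuclideanSpace.inner_single_right]

theorem graphPoint_eq {n : ℕ} (h : Rn n → ℝ) (ζ : Rn n) :
    graphPoint h ζ = graphInclusion n ζ + h ζ • EuclideanSpace.single (Fin.last n) 1 := by
  refine ext_inner_left ℝ fun ν => ?_
  rw [inner_add_right, inner_graphInclusion, real_inner_smul_right,
    EuclideanSpace.inner_single_right, PiLp.inner_apply, Fin.sum_univ_castSucc]
  simp [graphPoint]

theorem contDiffOn_graphPoint {n : ℕ} {h : Rn n → ℝ} {U : Set (Rn n)} (hh : ContDiffOn ℝ ∞ h U) :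
    ContDiffOn ℝ ∞ (graphPoint h) U := by
  rw [funext (graphPoint_eq h)]
  exact (graphInclusion n).contDiff.contDiffOn.add (hh.smul contDiffOn_const)

/-- The tangent vectors are `e_i + ∂_i h • e_last`, so a normal with zero last component would
vanish altogether. For a unit normal the second fundamental form is thus a nonzero multiple of the
Hessian. -/
theorem hasNondegenerateNormals_graphPoint {n : ℕ} {h : Rn n → ℝ} {U : Set (Rn n)}
    (hU : IsOpen U) (hh : ContDiffOn ℝ ∞ h U) {ζ : Rn n} (hζ : ζ ∈ U)
    (hdet : (hessian h ζ).det ≠ 0) : HasNondegenerateNormals (graphPoint h) ζ := by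
  intro ν hν h1 v h2
  set e : Rn (n + 1) := EuclideanSpace.single (Fin.last n) 1 with he
  have hνe : ⟪ν, e⟫_ℝ = ν (Fin.last n) := by simp [he, EuclideanSpace.inner_single_right]
  have hd : ∀ x ∈ U, fderiv ℝ (graphPoint h) x =
      graphInclusion n + (fderiv ℝ h x).smulRight e := fun x hx => by
    rw [funext (graphPoint_eq h)]
    exact ((graphInclusion n).hasFDerivAt.add
      (((hh.contDiffAt (hU.mem_nhds hx)).differentiableAt (by simp)).hasFDerivAt.smul_const
        e)).fderiv
  have hd2 : ∀ w, fderiv ℝ (fderiv ℝ (graphPoint h)) ζ v w =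
      (fderiv ℝ (fderiv ℝ h) ζ v w) • e := fun w => by
    have heq : fderiv ℝ (graphPoint h) =ᶠ[𝓝 ζ]
        fun x => graphInclusion n + (fderiv ℝ h x).smulRight e := by
      filter_upwards [hU.mem_nhds hζ] with x hx using hd x hx
    have hh' : DifferentiableAt ℝ (fderiv ℝ h) ζ :=
      ((hh.contDiffAt (hU.mem_nhds hζ)).fderiv_right (m := 1) (by norm_cast)).differentiableAt
        (by simp)
    have := (((ContinuousLinearMap.smulRightL ℝ (Rn n) (Rn (n + 1))).flip e).hasFDerivAt.comp ζ
      hh'.hasFDerivAt).const_add (graphInclusion n)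
    rw [heq.fderiv_eq]
    have h3 := congrArg (fun L => L v w) this.fderiv
    simpa using! h3
  by_cases hlast : ν (Fin.last n) = 0
  · exfalso
    have hzero : ν = 0 := by
      ext i
      refine Fin.lastCases hlast (fun i => ?_) i
      have := h1 (EuclideanSpace.single i 1)
      rw [hd ζ hζ, add_apply, inner_add_right, inner_graphInclusion,
        ContinuousLinearMap.smulRight_apply, real_inner_smul_right, hνe, hlast] at this
      simpa [Pi.single_apply] using this
    rw [hzero, norm_zero] at hν
    exact zero_ne_one hν
  · have h4 : ∀ w, fderiv ℝ (fderiv ℝ h) ζ v w = 0 := fun w => by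
      have := h2 w
      rw [hd2, real_inner_smul_right, hνe] at this
      exact (mul_eq_zero.1 this).resolve_right hlast
    have h5 : Matrix.vecMul (fun i => v i) (hessian h ζ) = 0 := by
      funext j
      have hv : v = ∑ i, v i • EuclideanSpace.single i (1 : ℝ) := by
        ext j; simp [Pi.single_apply]
      have := h4 (EuclideanSpace.single j 1)
      rw [hv, map_sum, sum_apply] at this
      simp only [map_smul, smul_apply, smul_eq_mul] at this
      simpa [Matrix.vecMul, dotProduct, hessian, iteratedFDeriv_two_apply] using this
    have h6 := Matrix.eq_zero_of_vecMul_eq_zero hdet h5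
    ext i
    exact congrFun h6 i

/-! ### Hypersurfaces -/

/-- A nonzero vector in the kernel of the second fundamental form is a principal direction with
curvature `0`. -/
theorem LocalParam.hasNondegenerateNormals {n : ℕ} {S : Set (Rn (n + 1))}
    (hS : NonvanishingPrincipalCurvatures S) (P : LocalParam S) {ζ : Rn n}
    (hζ : ζ ∈ P.chart.source) : HasNondegenerateNormals P.map ζ := by
  intro ν hν h1 v h2
  by_contra hv
  refine hS P ζ hζ ν hν (fun v => by rw [real_inner_comm]; exact h1 v) 0 ⟨v, hv, fun w => ?_⟩ rfl
  rw [zero_mul, real_inner_comm, iteratedFDeriv_two_apply]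
  exact h2 w

variable {n : ℕ} {S K : Set (Rn (n + 1))}

theorem ChartSystem.localize_mul (A : ChartSystem S K) (j : Fin A.N) (F G : Rn (n + 1) → ℂ)
    (ζ : Rn n) :
    A.localize j (fun ξ => F ξ * G ξ) ζ = A.localize j F ζ * G ((A.param j).map ζ) := by
  unfold ChartSystem.localize
  by_cases hζ : ζ ∈ (A.param j).chart.source
  · simp only [Set.indicator_of_mem hζ, mul_assoc]
  · simp only [Set.indicator_of_notMem hζ, zero_mul]

/-- The part of the domain of the `j`-th parametrization that is mapped into the support of the
cutoff. -/
def ChartSystem.cutoffDomain (A : ChartSystem S K) (j : Fin A.N) : Set (Rn n) :=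
  (A.param j).chart.symm '' (Subtype.val ⁻¹' tsupport (A.χ j))

theorem ChartSystem.isCompact_cutoffDomain (A : ChartSystem S K) (hS : IsClosed S)
    (j : Fin A.N) : IsCompact (A.cutoffDomain j) :=
  (hS.isClosedEmbedding_subtypeVal.isCompact_preimage (A.compact j).isCompact).image_of_continuousOn
    ((A.param j).chart.continuousOn_symm.mono fun p hp => A.subordinate j p hp)

theorem ChartSystem.cutoffDomain_subset (A : ChartSystem S K) (j : Fin A.N) :
    A.cutoffDomain j ⊆ (A.param j).chart.source := by
  rintro _ ⟨p, hp, rfl⟩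
  exact (A.param j).chart.map_target (A.subordinate j p hp)

theorem ChartSystem.localize_eq_zero (A : ChartSystem S K) (j : Fin A.N) (F : Rn (n + 1) → ℂ)
    {ζ : Rn n} (hζ : ζ ∉ A.cutoffDomain j) : A.localize j F ζ = 0 := by
  unfold ChartSystem.localize
  by_cases hs : ζ ∈ (A.param j).chart.source
  · have h0 : A.χ j ((A.param j).map ζ) = 0 := by
      refine image_eq_zero_of_notMem_tsupport fun h => hζ ⟨(A.param j).chart ζ, h, ?_⟩
      exact (A.param j).chart.left_inv hs
    rw [Set.indicator_of_mem hs, h0, Complex.ofReal_zero, zero_mul]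
  · exact Set.indicator_of_notMem hs _

theorem ChartSystem.tsupport_localize_subset (A : ChartSystem S K) (hS : IsClosed S)
    (j : Fin A.N) (F : Rn (n + 1) → ℂ) : tsupport (A.localize j F) ⊆ A.cutoffDomain j :=
  closure_minimal (fun _ hζ => by_contra fun h => hζ (A.localize_eq_zero j F h))
    (A.isCompact_cutoffDomain hS j).isClosed

theorem ChartSystem.hasCompactSupport_localize (A : ChartSystem S K) (hS : IsClosed S)
    (j : Fin A.N) (F : Rn (n + 1) → ℂ) : HasCompactSupport (A.localize j F) :=
  HasCompactSupport.intro (A.isCompact_cutoffDomain hS j) fun _ hζ => A.localize_eq_zero j F hζ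

/-- Extension by zero is smooth because the localized function vanishes off `cutoffDomain`, a
compact subset of the chart's source. Its compactness rests on `S` being closed. -/
theorem ChartSystem.contDiff_localize (A : ChartSystem S K) (hS : IsClosed S) (j : Fin A.N)
    {F : Rn (n + 1) → ℂ} (hF : ContDiff ℝ ∞ F) : ContDiff ℝ ∞ (A.localize j F) := by
  refine contDiff_iff_contDiffAt.2 fun ζ => ?_
  by_cases hζ : ζ ∈ (A.param j).chart.source
  · have hnhds := (A.param j).chart.open_source.mem_nhds hζ
    have hmap : ContDiffAt ℝ ∞ (A.param j).map ζ := (A.param j).smooth.contDiffAt hnhds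
    have h1 : ContDiffAt ℝ ∞ (fun ζ => (A.χ j ((A.param j).map ζ) : ℂ) * F ((A.param j).map ζ)) ζ :=
      (Complex.ofRealCLM.contDiff.contDiffAt.comp ζ
        ((A.smooth j).contDiffAt.comp ζ hmap)).mul (hF.contDiffAt.comp ζ hmap)
    refine h1.congr_of_eventuallyEq ?_
    filter_upwards [hnhds] with x hx using Set.indicator_of_mem hx _
  · refine (contDiffAt_const (c := (0 : ℂ))).congr_of_eventuallyEq ?_
    filter_upwards [(A.isCompact_cutoffDomain hS j).isClosed.isOpen_compl.mem_nhds
      fun h => hζ (A.cutoffDomain_subset j h)] with x hx using A.localize_eq_zero j F hx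

end Traces

/-- The dimension is `d = 2 * m + 1`, so that `(d - 1) / 2 = m`.

First part (local form): for a graph with nondegenerate Hessian, the map
`f ↦ ψ · (∂_d^m f̂)(·, h(·))`, classically defined on Schwartz functions, extends continuously to
`L_1(ℝ^d)`, with a bound in `B_2^{-m, ∞}(ℝ^{d-1})`.

Second part (global form): for a closed hypersurface `S` with nonvanishing principal curvatures
and a smooth compactly supported `φ`, the trace `f ↦ (φ ∇^m f̂)|_S`, classically defined on Schwartz
functions, extends continuously to `L_1(ℝ^d)`, with bounds in `B_2^{-m, ∞}(S)` and in `H^{-s}(S)`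
for every `s > m`. Here `T j α` is the localized piece number `j` of the component `α` of the
trace. -/
theorem corollary6p6 (m : ℕ) :
    (∀ (U : Set (Rn (2 * m))) (h : Rn (2 * m) → ℝ) (ψ : Rn (2 * m) → ℂ),
      IsOpen U → ContDiffOn ℝ ∞ h U → (∀ ζ ∈ U, (hessian h ζ).det ≠ 0) →
      ContDiff ℝ ∞ ψ → HasCompactSupport ψ → tsupport ψ ⊆ U →
      ∃ T : Lp ℂ 1 (volume : Measure (Rn (2 * m + 1))) →L[ℂ] 𝓢'(Rn (2 * m), ℂ),
        (∀ f : 𝓢(Rn (2 * m + 1), ℂ), IsGivenBy (T (f.toLp 1))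
          (fun ζ => ψ ζ * gradFourier f (fun _ : Fin m => Fin.last (2 * m)) (graphPoint h ζ))) ∧
        ∃ C : ℝ≥0, ∀ f, besovNorm (-(m : ℝ)) (T f) ≤ C * ‖f‖ₑ) ∧
    (∀ (S : Set (Rn (2 * m + 1))) (φ : Rn (2 * m + 1) → ℂ),
      IsClosed S → IsSmoothHypersurface S → NonvanishingPrincipalCurvatures S →
      ContDiff ℝ ∞ φ → HasCompactSupport φ →
      ∀ A : ChartSystem S (tsupport φ),
      ∃ T : Fin A.N → (Fin m → Fin (2 * m + 1)) →
          (Lp ℂ 1 (volume : Measure (Rn (2 * m + 1))) →L[ℂ] 𝓢'(Rn (2 * m), ℂ)),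
        (∀ (f : 𝓢(Rn (2 * m + 1), ℂ)) (j : Fin A.N) (α : Fin m → Fin (2 * m + 1)),
          IsGivenBy (T j α (f.toLp 1)) (A.localize j (fun ξ => φ ξ * gradFourier f α ξ))) ∧
        (∃ C : ℝ≥0, ∀ f, ∑ j, ∑ α, besovNorm (-(m : ℝ)) (T j α f) ≤ C * ‖f‖ₑ) ∧
        ∀ s : ℝ, (m : ℝ) < s →
          ∃ C : ℝ≥0, ∀ f, ∑ j, ∑ α, sobolevNorm (-s) (T j α f) ≤ C * ‖f‖ₑ) := by
  refine ⟨fun U h ψ hU hh hdet hψ hψc hψU => ?_, fun S φ hS _ hcurv hφ _ A => ?_⟩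
  · obtain ⟨T, hT, hB, -⟩ := exists_trace_gradFourier hU (contDiffOn_graphPoint hh) hψ hψc hψU
      (fun ζ hζ => hasNondegenerateNormals_graphPoint hU hh hζ (hdet ζ hζ))
      (fun _ => Fin.last (2 * m))
    exact ⟨T, hT, hB⟩
  -- The amplitude for chart `j` is the localization of `φ` alone; `localize_mul` then pulls the
  -- derivative of the transform out as the factor evaluated along the parametrization.
  · have key := fun (j : Fin A.N) (α : Fin m → Fin (2 * m + 1)) =>
      exists_trace_gradFourier (A.param j).chart.open_source (A.param j).smooth
        (A.contDiff_localize hS j hφ) (A.hasCompactSupport_localize hS j φ)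
        ((A.tsupport_localize_subset hS j φ).trans (A.cutoffDomain_subset j))
        (fun ζ hζ => (A.param j).hasNondegenerateNormals hcurv hζ) α
    choose T hT hB hH using key
    refine ⟨T, fun f j α => ?_, ?_, fun s hs => ?_⟩
    · rw [funext (A.localize_mul j φ (gradFourier f α))]
      exact hT j α f
    · choose C hC using hB
      refine ⟨∑ j, ∑ α, C j α, fun f => ?_⟩
      simp only [ENNReal.ofNNReal_finsetSum, Finset.sum_mul]
      gcongr with j _ α _
      exact hC j α f
    · choose C hC using fun j α => hH j α s hs
      refine ⟨∑ j, ∑ α, C j α, fun f => ?_⟩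
      simp only [ENNReal.ofNNReal_finsetSum, Finset.sum_mul]
      gcongr with j _ α _
      exact hC j α f
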